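/- Let $(G_n)_{n\ge 1}$ be a sequence of non-trivial finite groups, and let $\mathcal G_n=G_n\wr S_n$ be the complete monomial group: its elements are the tuples $(g_1,\dots,g_n;\pi)$ with $g_i\in G_n$, $\pi\in S_n$, and $(g_1,\dots,g_n;\pi)(h_1,\dots,h_n;\eta)=(g_1h_{\pi^{-1}(1)},\dots,g_nh_{\pi^{-1}(n)};\pi\eta)$. Let $P$ be the probability measure on $\mathcal G_n$ (warp-transpose top with random shuffle) that gives mass $\frac{1}{n|G_n|}$ to each element $(1,\dots,1,g;\mathrm{id})$, $g\in G_n$, and to each element $(1,\dots,1,g^{-1},1,\dots,1,g;(i,n))$ with $g^{-1}$ in position $i$ and $g$ in position $n$, $g\in G_n$, $1\le i<n$, and mass $0$ to every other element. Let $\mathscr P$ be the probability measure on $S_n$ (transpose top with random shuffle) that gives mass $\frac1n$ to the identity and to each transposition $(i,n)$, $1\le i<n$. For a measure $p$ on a finite group let $p^{*k}$ be its $k$-fold convolution power, where $(p*q)(x)=\sum_y p(xy^{-1})q(y)$; let $U_\Gamma$ be the uniform distribution on a finite group $\Gamma$, and let $\|\mu-\nu\|_{\mathrm{TV}}=\sup_A|\mu(A)-\nu(A)|$.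 There is a universal constant $a$ (independent of $n$, $C$, $k$ and the groups $G_n$) such that \[\bigl\|\mathscr P^{*\lceil n\log n+Cn\rceil}-U_{S_n}\bigr\|_{\mathrm{TV}}\le a e^{-C}\qquad\text{for all } n\ge 1 \text{ and } C>1,\] and such that the following hold for every such sequence $(G_n)$. 1. For all $n\ge 1$, all $C>1$ and all integers $k\ge n\log n+Cn$, \[\bigl\|P^{*k}-U_{\mathcal G_n}\bigr\|_{\mathrm{TV}}<a e^{-C}+(e+1)e^{-C/2}.\] 2. For every $\epsilon\in(0,1)$, \[\lim_{n\to\infty}\bigl\|P^{*\lfloor(1+\epsilon)n\log n\rfloor}-U_{\mathcal G_n}\bigr\|_{\mathrm{TV}}=0.\] -/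

import Mathlib

noncomputable section

namespace WarpShuffle

/-- The action of `S_n` on `G^n` by permuting coordinates: `(π • h) i = h (π⁻¹ i)`. -/
def permAut (n : ℕ) (G : Type*) [Group G] :
    Equiv.Perm (Fin n) →* MulAut (Fin n → G) where
  toFun π :=
    { toFun := fun h i => h (π⁻¹ i)
      invFun := fun h i => h (π i)
      left_inv := fun h => by ext i; simp
      right_inv := fun h => by ext i; simp
      map_mul' := fun _ _ => rfl }
  map_one' := by ext h i; simp
  map_mul' π η := by ext h i; simp [mul_inv_rev]

/-- The complete monomial group `G ≀ S_n`. Elements are pairs `(g_1, …, g_n; π)`, with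
`(g; π) (h; η) = (i ↦ g_i h_{π⁻¹(i)}; π η)`. -/
abbrev MonomialGroup (n : ℕ) (G : Type*) [Group G] : Type _ :=
  (Fin n → G) ⋊[permAut n G] Equiv.Perm (Fin n)

instance (n : ℕ) (G : Type*) [Group G] [Fintype G] : Fintype (MonomialGroup n G) := by
  classical exact Fintype.ofEquiv _ SemidirectProduct.equivProd.symm

/-- The last of the `n` positions (the "`n`-th position"). -/
def top (n : ℕ+) : Fin n := ⟨n - 1, Nat.sub_lt n.pos one_pos⟩

/-- The element `(1, …, 1, g; 1)` of `G ≀ S_n`. -/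
def lastElt (n : ℕ+) {G : Type*} [Group G] (g : G) : MonomialGroup n G :=
  ⟨Pi.mulSingle (top n) g, 1⟩

/-- The element `(1, …, 1, g⁻¹, 1, …, 1, g; (i, n))` of `G ≀ S_n`, with `g⁻¹` in position `i`
and `g` in position `n`; only used for `i ≠ n`. -/
def warpElt (n : ℕ+) {G : Type*} [Group G] (i : Fin n) (g : G) : MonomialGroup n G :=
  ⟨Pi.mulSingle i g⁻¹ * Pi.mulSingle (top n) g, Equiv.swap i (top n)⟩

open Classical in
/-- The measure `P` on `G ≀ S_n` driving the warp-transpose top with random shuffle. -/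
def warpMeasure (n : ℕ+) (G : Type*) [Group G] [Fintype G] (x : MonomialGroup n G) : ℝ :=
  if (∃ g : G, x = lastElt n g) ∨ (∃ g : G, ∃ i : Fin n, i ≠ top n ∧ x = warpElt n i g) then
    1 / ((n : ℝ) * (Fintype.card G : ℝ))
  else 0

open Classical in
/-- The measure on `S_n` driving the transpose top with random shuffle. -/
def transposeTopMeasure (n : ℕ+) (π : Equiv.Perm (Fin n)) : ℝ :=
  if π = 1 ∨ ∃ i : Fin n, i ≠ top n ∧ π = Equiv.swap i (top n) then 1 / (n : ℝ) else 0

/-- Convolution of measures on a finite group, given by their point masses. -/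
def conv {Γ : Type*} [Group Γ] [Fintype Γ] (p q : Γ → ℝ) (x : Γ) : ℝ :=
  ∑ y : Γ, p (x * y⁻¹) * q y

open Classical in
/-- The `k`-fold convolution `p^{*k}`; `p^{*0}` is the unit mass at the identity. -/
def convPow {Γ : Type*} [Group Γ] [Fintype Γ] (p : Γ → ℝ) : ℕ → Γ → ℝ
  | 0 => fun x => if x = 1 then 1 else 0
  | k + 1 => conv (convPow p k) p

/-- The uniform distribution on a finite set. -/
def uniform (Ω : Type*) [Fintype Ω] (_ : Ω) : ℝ := 1 / (Fintype.card Ω : ℝ)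

/-- Total variation distance `sup_A |μ(A) - ν(A)|` of measures on a finite set. -/
def tvDist {Ω : Type*} [Fintype Ω] (μ ν : Ω → ℝ) : ℝ :=
  ⨆ A : Finset Ω, |∑ x ∈ A, μ x - ∑ x ∈ A, ν x|

end WarpShuffle

end

/-!
Write `x = n e^{-k/n}`. The distance of `𝒫^{*k}` to uniform is controlled by its `ℓ²`-norm, hence by
the number of closed walks of length `2k` in the star transpositions, which is a trace of the power
of an operator on functions on `S_n`. The functions `agreement A g` with `A` a proper subset span,
and the star operator is triangular on them when the sets are suitably ordered: a set `A` without
the centre contributes the eigenvalue `n - |A|`, and a set `A` containing it contributes copies of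
the star operator on `|A|` points. For even powers of a symmetric operator the trace is at most the
sum of the traces of the blocks, so induction on `n` bounds the excess of the trace over its trivial
part by a multiple of `x²`.

For the warp shuffle, average over the group elements of the steps along a fixed word of positions.
Once every position has been visited the outcome is invariant under the base group, so its law is
that of the shuffle on `S_n` made uniform along the fibres. Coupon collecting bounds the
contribution of the other words by `x`.
-/

noncomputable section

namespace WarpShuffle

section TraceComparison

variable {E V : Type*} [NormedAddCommGroup E] [InnerProductSpace ℝ E] [FiniteDimensional ℝ E]

lemma trace_even_pow_mul_starProjection_nonneg {g : Module.End ℝ E} (hg : g.IsSymmetric)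
    (K : Submodule ℝ E) (k : ℕ) :
    0 ≤ LinearMap.trace ℝ E (g ^ (2 * k) * K.starProjection.toLinearMap) := by
  set P : Module.End ℝ E := K.starProjection.toLinearMap
  have hP : P * P = P :=
    LinearMap.ext fun x => K.starProjection_eq_self_iff.2 (K.starProjection_apply_mem x)
  have hadj : (P * g ^ k).adjoint = g ^ k * P := by
    rw [Module.End.mul_eq_comp, LinearMap.adjoint_comp, (hg.pow k).adjoint_eq,
      K.starProjection_isSymmetric.adjoint_eq, Module.End.mul_eq_comp]
  calc 0 ≤ LinearMap.trace ℝ E ((P * g ^ k).adjoint * (P * g ^ k)) :=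
        (LinearMap.isPositive_adjoint_comp_self _).trace_nonneg
    _ = LinearMap.trace ℝ E (g ^ (2 * k) * P) := by
        rw [hadj, mul_assoc, ← mul_assoc P P, hP, LinearMap.trace_mul_comm, mul_assoc, ← pow_add,
          ← two_mul, LinearMap.trace_mul_comm]

variable [AddCommGroup V] [Module ℝ V] [FiniteDimensional ℝ V]

/- `tr f ^ (2 k)` is the trace of `g ^ (2 k)` compressed to `(ker Φ)ᗮ`, and the rest of
`tr g ^ (2 k)` is nonnegative because the power is even. -/
lemma trace_even_pow_le_of_intertwining {f : Module.End ℝ V} {g : Module.End ℝ E}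
    (hg : g.IsSymmetric) {Φ : E →ₗ[ℝ] V} (hΦ : Function.Surjective Φ) (h : f ∘ₗ Φ = Φ ∘ₗ g)
    (k : ℕ) :
    LinearMap.trace ℝ V (f ^ (2 * k)) ≤ LinearMap.trace ℝ E (g ^ (2 * k)) := by
  set P : Module.End ℝ E := Φ.ker.starProjection.toLinearMap
  have hΦP : Φ ∘ₗ P = 0 :=
    LinearMap.ext fun x => LinearMap.mem_ker.1 (Φ.ker.starProjection_apply_mem x)
  obtain ⟨Ψ₀, hΨ₀⟩ := Φ.exists_rightInverse_of_surjective (LinearMap.range_eq_top.2 hΦ)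
  set Ψ := (1 - P) ∘ₗ Ψ₀ with hΨ
  have hΦΨ : Φ ∘ₗ Ψ = LinearMap.id := by
    rw [hΨ, ← LinearMap.comp_assoc, LinearMap.comp_sub, hΦP, sub_zero]
    exact hΨ₀
  have hΨΦ : Ψ ∘ₗ Φ = 1 - P := by
    ext x
    have hker : Ψ₀ (Φ x) - x ∈ Φ.ker := by
      simpa [sub_eq_zero] using LinearMap.congr_fun hΨ₀ (Φ x)
    have hsub : (1 - P) (Ψ₀ (Φ x) - x) = 0 :=
      sub_eq_zero.2 (Φ.ker.starProjection_eq_self_iff.2 hker).symm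
    rwa [map_sub, sub_eq_zero] at hsub
  have hpow : (f ^ (2 * k) : Module.End ℝ V) ∘ₗ Φ = Φ ∘ₗ (g ^ (2 * k) : Module.End ℝ E) :=
    Module.End.commute_pow_left_of_commute h _
  have htrace : LinearMap.trace ℝ V (f ^ (2 * k)) =
      LinearMap.trace ℝ E (g ^ (2 * k) * (1 - P)) := by
    rw [← hΨΦ, Module.End.mul_eq_comp, ← LinearMap.comp_assoc, LinearMap.trace_comp_comm',
      ← LinearMap.comp_assoc, ← hpow, LinearMap.comp_assoc, hΦΨ, LinearMap.comp_id]
  rw [htrace, mul_sub, mul_one, map_sub]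
  exact sub_le_self _ (trace_even_pow_mul_starProjection_nonneg hg Φ.ker k)

lemma trace_toEuclideanLin_pow {Y : Type*} [Fintype Y] [DecidableEq Y] (S : Matrix Y Y ℝ) (k : ℕ) :
    LinearMap.trace ℝ (EuclideanSpace ℝ Y) (S.toEuclideanLin ^ k) = (S ^ k).trace := by
  rw [← Matrix.toLpLin_pow]
  exact Matrix.trace_toLin_eq _ (PiLp.basisFun 2 ℝ Y)

lemma trace_even_pow_le_of_span_eq_top {Y : Type*} [Fintype Y] [DecidableEq Y]
    {f : Module.End ℝ V} {S : Matrix Y Y ℝ} (hS : S.IsSymm) {ψ : Y → V}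
    (hψ : Submodule.span ℝ (Set.range ψ) = ⊤) (h : ∀ b, f (ψ b) = ∑ a, S a b • ψ a) (k : ℕ) :
    LinearMap.trace ℝ V (f ^ (2 * k)) ≤ (S ^ (2 * k)).trace := by
  set Φ : EuclideanSpace ℝ Y →ₗ[ℝ] V :=
    Fintype.linearCombination ℝ ψ ∘ₗ (WithLp.linearEquiv 2 ℝ (Y → ℝ)).toLinearMap
  have hΦ : Function.Surjective Φ := by
    rw [← LinearMap.range_eq_top, LinearMap.range_comp, LinearEquiv.range, Submodule.map_top,
      Fintype.range_linearCombination, hψ]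
  have hint : f ∘ₗ Φ = Φ ∘ₗ S.toEuclideanLin := by
    refine (EuclideanSpace.basisFun Y ℝ).toBasis.ext fun b => ?_
    simp [Φ, h, Fintype.linearCombination_apply, Matrix.toLpLin_apply]
  have hsymm : S.toEuclideanLin.IsSymmetric := Matrix.isSymmetric_toEuclideanLin_iff.2 (by
    rwa [Matrix.IsHermitian, Matrix.conjTranspose_eq_transpose_of_trivial])
  refine (trace_even_pow_le_of_intertwining hsymm hΦ hint k).trans_eq ?_
  exact trace_toEuclideanLin_pow S _

end TraceComparison

section Triangular

variable {V ι : Type*} [NormedAddCommGroup V] [InnerProductSpace ℝ V] {Y : ι → Type*}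

lemma starProjection_apply_comm {f : Module.End ℝ V} (hf : f.IsSymmetric) {F : Submodule ℝ V}
    [F.HasOrthogonalProjection] (hF : F ∈ f.invtSubmodule) (v : V) :
    F.starProjection (f v) = f (F.starProjection v) := by
  have hmem : f (F.starProjection v) ∈ F := hF (F.starProjection_apply_mem v)
  refine Submodule.eq_starProjection_of_mem_orthogonal hmem ?_
  rw [← map_sub]
  exact hf.orthogonalComplement_mem_invtSubmodule hF (F.sub_starProjection_mem_orthogonal v)

/-- The span of the blocks of rank less than `m`, in a family of vectors `φ i b` divided into
blocks `φ i`, the block `φ i` having rank `r i`. -/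
def spanBelow (r : ι → ℕ) (φ : ∀ i, Y i → V) (m : ℕ) : Submodule ℝ V :=
  Submodule.span ℝ {v | ∃ i b, r i < m ∧ φ i b = v}

variable {r : ι → ℕ} {φ : ∀ i, Y i → V}

lemma mem_spanBelow {i : ι} {m : ℕ} (hi : r i < m) (b : Y i) : φ i b ∈ spanBelow r φ m :=
  Submodule.subset_span ⟨i, b, hi, rfl⟩

lemma spanBelow_le_iff {m : ℕ} {W : Submodule ℝ V} :
    spanBelow r φ m ≤ W ↔ ∀ i b, r i < m → φ i b ∈ W := by
  rw [spanBelow, Submodule.span_le]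
  exact ⟨fun h i b hi => h ⟨i, b, hi, rfl⟩, by rintro h _ ⟨i, b, hi, rfl⟩; exact h i b hi⟩

variable [∀ i, Fintype (Y i)] {S : ∀ i, Matrix (Y i) (Y i) ℝ} {f : Module.End ℝ V}

lemma spanBelow_mem_invtSubmodule
    (h : ∀ i b, f (φ i b) - ∑ a, S i a b • φ i a ∈ spanBelow r φ (r i)) (m : ℕ) :
    spanBelow r φ m ∈ f.invtSubmodule := by
  refine spanBelow_le_iff.2 fun i b hi => ?_
  have hlower : spanBelow r φ (r i) ≤ spanBelow r φ m :=
    spanBelow_le_iff.2 fun j c hj => mem_spanBelow (hj.trans hi) c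
  change f (φ i b) ∈ spanBelow r φ m
  refine (Submodule.sub_mem_iff_left _ ?_).1 (hlower (h i b))
  exact Submodule.sum_mem _ fun a _ => Submodule.smul_mem _ _ (mem_spanBelow hi a)

variable [FiniteDimensional ℝ V] [Fintype ι] [∀ i, DecidableEq (Y i)]

/- Removing from each `φ i b` its projection onto the lower blocks makes the family intertwine `f`
with the block diagonal matrix of the `S i` exactly, since `f` commutes with these projections. -/
lemma trace_even_pow_le_sum_of_triangular (hf : f.IsSymmetric) (hS : ∀ i, (S i).IsSymm)
    (hspan : ⨆ i, Submodule.span ℝ (Set.range (φ i)) = ⊤)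
    (h : ∀ i b, f (φ i b) - ∑ a, S i a b • φ i a ∈ spanBelow r φ (r i)) (k : ℕ) :
    LinearMap.trace ℝ V (f ^ (2 * k)) ≤ ∑ i, (S i ^ (2 * k)).trace := by
  classical
  set P : ι → V →L[ℝ] V := fun i => (spanBelow r φ (r i)).starProjection with hP
  set ψ : (Σ i, Y i) → V := fun y => φ y.1 y.2 - P y.1 (φ y.1 y.2) with hψ
  have hφ : ∀ m i b, r i = m → φ i b ∈ Submodule.span ℝ (Set.range ψ) := by
    intro m
    induction m using Nat.strong_induction_on with
    | _ m ih =>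
      rintro i b rfl
      have hlower : P i (φ i b) ∈ Submodule.span ℝ (Set.range ψ) :=
        spanBelow_le_iff.2 (fun j c hj => ih _ hj j c rfl) (Submodule.starProjection_apply_mem _ _)
      have hψb : ψ ⟨i, b⟩ ∈ Submodule.span ℝ (Set.range ψ) := Submodule.subset_span ⟨_, rfl⟩
      simpa [hψ] using Submodule.add_mem _ hψb hlower
  have hψf : ∀ y, f (ψ y) = ∑ a, Matrix.blockDiagonal' S a y • ψ a := by
    rintro ⟨i, b⟩
    have hproj := (Submodule.starProjection_eq_self_iff).2 (h i b)
    rw [map_sub, starProjection_apply_comm hf (spanBelow_mem_invtSubmodule h _), map_sum] at hproj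
    have hblock : ∑ a, Matrix.blockDiagonal' S a ⟨i, b⟩ • ψ a = ∑ a, S i a b • ψ ⟨i, a⟩ := by
      rw [Fintype.sum_sigma, Fintype.sum_eq_single i]
      · simp only [Matrix.blockDiagonal'_apply_eq]
      · intro j hj
        simp only [Matrix.blockDiagonal'_apply_ne S _ _ hj, zero_smul, Finset.sum_const_zero]
    rw [hblock]
    simp only [hψ, hP, map_sub, map_smul, smul_sub, Finset.sum_sub_distrib] at hproj ⊢
    linear_combination (norm := module) (-1 : ℝ) • hproj
  have hψspan : Submodule.span ℝ (Set.range ψ) = ⊤ := by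
    refine top_le_iff.1 (hspan ▸ iSup_le fun i => Submodule.span_le.2 ?_)
    exact Set.range_subset_iff.2 fun b => hφ _ i b rfl
  have hsymm : (Matrix.blockDiagonal' S).IsSymm := by
    rw [Matrix.IsSymm, Matrix.blockDiagonal'_transpose]
    exact congrArg _ (funext hS)
  have htrace := trace_even_pow_le_of_span_eq_top hsymm hψspan hψf k
  rwa [← Matrix.blockDiagonal'_pow, Matrix.trace_blockDiagonal'] at htrace

end Triangular

section Words

lemma sum_pow_eq_sum_prod_ofFn {R ι : Type*} [Semiring R] [Fintype ι] (f : ι → R) (k : ℕ) :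
    (∑ i, f i) ^ k = ∑ w : Fin k → ι, (List.ofFn fun j => f (w j)).prod := by
  induction k with
  | zero => simp
  | succ k ih =>
    rw [pow_succ', ih, Finset.sum_mul_sum, ← (Fin.consEquiv fun _ => ι).sum_comp,
      Fintype.sum_prod_type]
    simp [List.ofFn_succ, Fin.consEquiv]

variable {Γ ι X : Type*} [Group Γ] [Fintype ι] [Fintype X] [DecidableEq X]

open Classical in
/-- The number of words of length `p` in the letters `s l` whose product is `1`, that is, of closed
walks of length `p` in the Cayley graph of the letters. -/
def closedWords (s : ι → Γ) (p : ℕ) : ℕ :=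
  (Finset.univ.filter fun w : Fin p → ι => (List.ofFn fun j => s (w j)).prod = 1).card

lemma closedWords_comp_le {κ : Type*} [Fintype κ] (s : ι → Γ) {f : κ → ι}
    (hf : Function.Injective f) (p : ℕ) : closedWords (s ∘ f) p ≤ closedWords s p := by
  classical
  exact Finset.card_le_card_of_injOn (fun w => f ∘ w) (fun w hw => by simpa using hw)
    (hf.comp_left.injOn)

lemma trace_sum_pow_eq_closedWords {R : Γ →* Matrix X X ℝ} (hR : ∀ a ≠ 1, (R a).trace = 0)
    (s : ι → Γ) (p : ℕ) :
    ((∑ l, R (s l)) ^ p).trace = Fintype.card X * closedWords s p := by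
  classical
  have hprod (w : Fin p → ι) :
      (List.ofFn fun j => R (s (w j))).prod = R (List.ofFn fun j => s (w j)).prod := by
    rw [map_list_prod, List.map_ofFn]
    rfl
  have htrace (a : Γ) : (R a).trace = if a = 1 then (Fintype.card X : ℝ) else 0 := by
    split_ifs with ha
    · rw [ha, map_one, Matrix.trace_one]
    · exact hR a ha
  simp only [sum_pow_eq_sum_prod_ofFn, Matrix.trace_sum, hprod, htrace, closedWords,
    Finset.card_filter, Nat.cast_sum, Nat.cast_ite, Nat.cast_one, Nat.cast_zero, Finset.mul_sum,
    mul_ite, mul_one, mul_zero]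

/-- The permutation matrices of an action `ρ` of a group on a finite set. -/
def permRep (ρ : Γ →* Equiv.Perm X) : Γ →* Matrix X X ℝ :=
  Matrix.permMatrixHom.comp ρ

variable (ρ : Γ →* Equiv.Perm X) (a : Γ)

lemma permRep_apply : permRep ρ a = (ρ a)⁻¹.permMatrix ℝ := rfl

lemma permRep_apply_apply (x y : X) : permRep ρ a x y = if ρ a y = x then 1 else 0 := by
  rw [permRep_apply, Equiv.Perm.permMatrix, PEquiv.toMatrix_apply]
  refine if_congr ?_ rfl rfl
  rw [Equiv.toPEquiv_apply, Option.mem_some_iff, Equiv.Perm.inv_eq_iff_eq, eq_comm]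

lemma sum_permRep_smul {V : Type*} [AddCommGroup V] [Module ℝ V] (y : X) (φ : X → V) :
    ∑ x, permRep ρ a x y • φ x = φ (ρ a y) := by
  simp only [permRep_apply_apply, ite_smul, one_smul, zero_smul, Finset.sum_ite_eq,
    Finset.mem_univ, if_true]

lemma permRep_mulVec (v : X → ℝ) (x : X) : (permRep ρ a).mulVec v x = v ((ρ a)⁻¹ x) := by
  rw [permRep_apply, Matrix.permMatrix_mulVec]
  rfl

lemma transpose_permRep : (permRep ρ a).transpose = permRep ρ a⁻¹ := by
  rw [permRep_apply, permRep_apply, Matrix.transpose_permMatrix, map_inv]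

lemma trace_permRep_of_fixedPointFree (h : ∀ x, ρ a x ≠ x) : (permRep ρ a).trace = 0 := by
  rw [permRep_apply, Matrix.trace_permutation, Nat.cast_eq_zero, Set.ncard_eq_zero]
  refine Set.eq_empty_of_forall_notMem fun x hx => h x ?_
  rw [← Equiv.Perm.eq_inv_iff_eq]
  exact hx.symm

variable {ρ}

lemma isSymm_sum_permRep {s : ι → Γ} (hs : ∀ l, (s l)⁻¹ = s l) :
    (∑ l, permRep ρ (s l)).IsSymm := by
  simp only [Matrix.IsSymm, Matrix.transpose_sum, transpose_permRep, hs]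

lemma trace_sum_permRep_pow (hρ : ∀ a ≠ 1, ∀ x, ρ a x ≠ x) (s : ι → Γ) (p : ℕ) :
    ((∑ l, permRep ρ (s l)) ^ p).trace = Fintype.card X * closedWords s p :=
  trace_sum_pow_eq_closedWords (fun a ha => trace_permRep_of_fixedPointFree ρ a (hρ a ha)) s p

end Words

section StarTranspositions

variable {α : Type*} [DecidableEq α] (o : α)

/-- The star transpositions with centre `o`, as letters indexed by all of `α`; the letter `o` is
the identity. -/
def starSwap (l : α) : Equiv.Perm α := Equiv.swap l o

lemma starSwap_inv (l : α) : (starSwap o l)⁻¹ = starSwap o l := Equiv.swap_inv l o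

lemma starSwap_injective : Function.Injective (starSwap o) :=
  Function.LeftInverse.injective (g := fun σ => σ o) fun l => Equiv.swap_apply_right l o

variable [Fintype α]

/-- The operator summing the left translations by the star transpositions. -/
def starOperator : Module.End ℝ (EuclideanSpace ℝ (Equiv.Perm α)) :=
  (∑ l, permRep (MulAction.toPermHom (Equiv.Perm α) (Equiv.Perm α)) (starSwap o l)).toEuclideanLin

/-- The indicator function of the permutations that send `g a` to `a` for all `a ∈ A`. -/
def agreement (A : Finset α) (g : α → α) : EuclideanSpace ℝ (Equiv.Perm α) :=
  WithLp.toLp 2 fun π => if ∀ a ∈ A, π (g a) = a then 1 else 0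

lemma starOperator_isSymmetric : (starOperator o).IsSymmetric := by
  refine Matrix.isSymmetric_toEuclideanLin_iff.2 ?_
  rw [Matrix.IsHermitian, Matrix.conjTranspose_eq_transpose_of_trivial]
  exact isSymm_sum_permRep (starSwap_inv o)

lemma trace_starOperator_pow (p : ℕ) :
    LinearMap.trace ℝ _ (starOperator o ^ p) =
      (Fintype.card α).factorial * closedWords (starSwap o) p := by
  rw [starOperator, trace_toEuclideanLin_pow, trace_sum_permRep_pow, Fintype.card_perm]
  exact fun a ha π => by simpa using ha

variable {o} {A : Finset α} {g : α → α}

lemma agreement_apply (π : Equiv.Perm α) :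
    agreement A g π = if ∀ a ∈ A, π (g a) = a then 1 else 0 := rfl

lemma agreement_congr {g' : α → α} (h : ∀ a ∈ A, g a = g' a) : agreement A g = agreement A g' := by
  ext π
  simp only [agreement_apply]
  congr 1
  exact propext (forall₂_congr fun a ha => by rw [h a ha])

lemma starOperator_apply (v : EuclideanSpace ℝ (Equiv.Perm α)) (π : Equiv.Perm α) :
    starOperator o v π = ∑ l, v (starSwap o l * π) := by
  simp only [starOperator, Matrix.toLpLin_apply, Matrix.sum_mulVec, Finset.sum_apply,
    permRep_mulVec, ← map_inv, starSwap_inv]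
  rfl

lemma agreement_starSwap_mul (l : α) (π : Equiv.Perm α) :
    agreement A g (starSwap o l * π) =
      agreement (A.map (starSwap o l).toEmbedding) (g ∘ starSwap o l) π := by
  simp only [agreement_apply, Finset.forall_mem_map, starSwap, Equiv.Perm.mul_apply,
    Function.comp_apply, Equiv.toEmbedding_apply, Equiv.swap_apply_self, Equiv.swap_apply_eq_iff]

lemma agreement_starSwap_mul_of_mem {l : α} (ho : o ∈ A) (hl : l ∈ A) (π : Equiv.Perm α) :
    agreement A g (starSwap o l * π) = agreement A (g ∘ starSwap o l) π := by
  rw [agreement_starSwap_mul, show A.map (starSwap o l).toEmbedding = A from ?_]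
  ext a
  rw [Finset.mem_map_equiv, starSwap, Equiv.symm_swap, Equiv.swap_apply_def]
  grind

lemma agreement_starSwap_mul_of_notMem {l : α} (ho : o ∉ A) (hl : l ∉ A) (π : Equiv.Perm α) :
    agreement A g (starSwap o l * π) = agreement A g π := by
  simp only [agreement_apply, starSwap, Equiv.Perm.mul_apply, Equiv.swap_apply_eq_iff]
  refine if_congr (forall₂_congr fun a ha => ?_) rfl rfl
  rw [Equiv.swap_apply_of_ne_of_ne (ne_of_mem_of_not_mem ha hl) (ne_of_mem_of_not_mem ha ho)]

lemma starOperator_agreement_of_notMem (ho : o ∉ A) :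
    starOperator o (agreement A g) = ((Fintype.card α : ℝ) - A.card) • agreement A g +
      ∑ l ∈ A, agreement (insert o (A.erase l)) (g ∘ starSwap o l) := by
  ext π
  have hmem (l) (hl : l ∈ A) : A.map (starSwap o l).toEmbedding = insert o (A.erase l) := by
    ext a
    rw [Finset.mem_map_equiv, starSwap, Equiv.symm_swap, Equiv.swap_apply_def]
    grind
  rw [starOperator_apply, ← Finset.sum_compl_add_sum A]
  simp only [PiLp.add_apply, PiLp.smul_apply, WithLp.ofLp_sum, Finset.sum_apply]
  congr 1
  · rw [Finset.sum_congr rfl fun l hl =>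
        agreement_starSwap_mul_of_notMem ho (Finset.mem_compl.1 hl) π,
      Finset.sum_const, Finset.card_compl, nsmul_eq_mul, Nat.cast_sub A.card_le_univ, smul_eq_mul]
  · exact Finset.sum_congr rfl fun l hl => by rw [agreement_starSwap_mul, hmem l hl]

/- If `π` agrees with `g` on `A \ {o}`, then exactly one of the letters outside `A \ {o}`, namely
`π (g o)`, makes it agree with `g` at `o` as well. -/
lemma sum_compl_erase_agreement_starSwap_mul (ho : o ∈ A) (hg : Set.InjOn g A)
    (π : Equiv.Perm α) :
    ∑ l ∈ (A.erase o)ᶜ, agreement A g (starSwap o l * π) = agreement (A.erase o) g π := by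
  have hiff (l) (hl : l ∉ A.erase o) : (∀ a ∈ A, (starSwap o l * π) (g a) = a) ↔
      π (g o) = l ∧ ∀ a ∈ A.erase o, π (g a) = a := by
    conv_lhs => rw [← Finset.insert_erase ho, Finset.forall_mem_insert]
    simp only [starSwap, Equiv.Perm.mul_apply, Equiv.swap_apply_eq_iff, Equiv.swap_apply_right]
    refine and_congr_right fun _ => forall₂_congr fun a ha => ?_
    rw [Equiv.swap_apply_of_ne_of_ne (ne_of_mem_of_not_mem ha hl) (Finset.ne_of_mem_erase ha)]
  simp only [agreement_apply]
  rw [Finset.sum_congr rfl fun l hl => if_congr (hiff l (Finset.mem_compl.1 hl)) rfl rfl]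
  by_cases hπ : ∀ a ∈ A.erase o, π (g a) = a
  · have hgo : π (g o) ∉ A.erase o := fun hmem =>
      Finset.ne_of_mem_erase hmem
        (hg (Finset.mem_of_mem_erase hmem) ho (π.injective (hπ _ hmem)))
    simp only [and_iff_left hπ, if_pos hπ, Finset.sum_ite_eq, if_pos (Finset.mem_compl.2 hgo)]
  · simp only [if_neg hπ, if_neg fun h => hπ (And.right h), Finset.sum_const_zero]

lemma starOperator_agreement_of_mem (ho : o ∈ A) (hg : Set.InjOn g A) :
    starOperator o (agreement A g) = ∑ l ∈ A.erase o, agreement A (g ∘ starSwap o l) +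
      agreement (A.erase o) g := by
  ext π
  rw [starOperator_apply, ← Finset.sum_add_sum_compl (A.erase o),
    sum_compl_erase_agreement_starSwap_mul ho hg,
    Finset.sum_congr rfl fun l hl =>
      agreement_starSwap_mul_of_mem ho (Finset.mem_of_mem_erase hl) π]
  simp only [PiLp.add_apply, WithLp.ofLp_sum, Finset.sum_apply]

lemma extend_injOn {β γ : Type*} {B : Finset β} (g : B ↪ γ) (g₀ : β → γ) :
    Set.InjOn (Function.extend Subtype.val g g₀) B := by
  intro a ha b hb hab
  lift a to B using ha
  lift b to B using hb
  rw [Subtype.val_injective.extend_apply, Subtype.val_injective.extend_apply] at hab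
  rw [g.injective hab]

/-- The action of the permutations of `β` on the embeddings of `β` by precomposition with the
inverse. -/
def embeddingAction (β γ : Type*) : Equiv.Perm β →* Equiv.Perm (β ↪ γ) where
  toFun u := u.embeddingCongr (Equiv.refl γ)
  map_one' := rfl
  map_mul' _ _ := rfl

lemma embeddingAction_apply_apply {β γ : Type*} (u : Equiv.Perm β) (g : β ↪ γ) (b : β) :
    embeddingAction β γ u g b = g (u⁻¹ b) := rfl

lemma embeddingAction_free {β γ : Type*} {u : Equiv.Perm β} (hu : u ≠ 1) (g : β ↪ γ) :
    embeddingAction β γ u g ≠ g := by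
  refine fun h => hu (inv_eq_one.1 (Equiv.ext fun b => g.injective ?_))
  exact DFunLike.congr_fun h b

variable (o) in
/-- The action of the star transpositions on the span of the functions `agreement A g`, for a fixed
set `A` and `g` ranging over the embeddings of `A`, up to agreements on sets of lower rank. -/
def starBlock (A : Finset α) : Matrix (A ↪ α) (A ↪ α) ℝ :=
  if h : o ∈ A then
    ∑ l : A.erase o, permRep (embeddingAction A α)
      (starSwap ⟨o, h⟩ (Subtype.map id (fun _ => Finset.mem_of_mem_erase) l))
  else ((Fintype.card α : ℝ) - A.card) • 1

variable (o) in
/-- The rank of a set in the triangular form of the star operator: sets are ordered by size, and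
among the sets of the same size those containing `o` come first. -/
def starRank (A : Finset α) : ℕ := 2 * A.card + if o ∈ A then 0 else 1

/-- The function `agreement A g` for an embedding `g` of `A`. -/
def agreementEmb (A : Finset α) (g : A ↪ α) : EuclideanSpace ℝ (Equiv.Perm α) :=
  agreement A (Function.extend Subtype.val g id)

lemma agreementEmb_of_injOn (hg : Set.InjOn g A) :
    agreementEmb A ⟨A.restrict g, Set.injOn_iff_injective.1 hg⟩ = agreement A g :=
  agreement_congr fun a ha => Subtype.val_injective.extend_apply (A.restrict g) id ⟨a, ha⟩

lemma trace_starBlock_pow_of_notMem (h : o ∉ A) (p : ℕ) :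
    (starBlock o A ^ p).trace =
      (Fintype.card α).descFactorial A.card * ((Fintype.card α : ℝ) - A.card) ^ p := by
  rw [starBlock, dif_neg h, smul_pow, one_pow, Matrix.trace_smul, Matrix.trace_one,
    Fintype.card_embedding_eq, Fintype.card_coe, smul_eq_mul, mul_comm]

lemma trace_starBlock_pow_le_of_mem (h : o ∈ A) (p : ℕ) :
    (starBlock o A ^ p).trace ≤
      (Fintype.card α).descFactorial A.card * closedWords (starSwap (⟨o, h⟩ : A)) p := by
  rw [starBlock, dif_pos h, trace_sum_permRep_pow (fun u hu => embeddingAction_free hu),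
    Fintype.card_embedding_eq, Fintype.card_coe]
  gcongr
  exact closedWords_comp_le (κ := A.erase o) (starSwap (⟨o, h⟩ : A))
    (Subtype.map_injective _ Function.injective_id) p

lemma starBlock_isSymm : (starBlock o A).IsSymm := by
  unfold starBlock
  split_ifs with h
  · exact isSymm_sum_permRep fun l => starSwap_inv _ _
  · exact Matrix.isSymm_one.smul _

variable (o) in
/-- The span of the agreement indicators of rank less than `m`. -/
def agreementsBelow (m : ℕ) : Submodule ℝ (EuclideanSpace ℝ (Equiv.Perm α)) :=
  spanBelow (fun A : {A : Finset α // A ≠ Finset.univ} => starRank o A)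
    (fun A => agreementEmb A.1) m

lemma agreement_mem_agreementsBelow {m : ℕ} (hA : A ≠ Finset.univ) (hg : Set.InjOn g A)
    (hm : starRank o A < m) : agreement A g ∈ agreementsBelow o m := by
  rw [← agreementEmb_of_injOn hg]
  exact Submodule.subset_span ⟨⟨A, hA⟩, _, hm, rfl⟩

lemma agreementEmb_embeddingAction_starSwap {l : α} (ho : o ∈ A) (hl : l ∈ A) (g : A ↪ α) :
    agreementEmb A (embeddingAction A α (starSwap ⟨o, ho⟩ ⟨l, hl⟩) g) =
      agreement A (Function.extend Subtype.val g id ∘ starSwap o l) := by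
  refine agreement_congr fun a ha => ?_
  have hcoe : starSwap o l a = (starSwap (⟨o, ho⟩ : A) ⟨l, hl⟩ ⟨a, ha⟩ : A) := by
    rw [starSwap, starSwap, ← Subtype.val_injective.swap_apply]
  rw [Function.comp_apply, hcoe, Subtype.val_injective.extend_apply,
    Subtype.val_injective.extend_apply _ _ (⟨a, ha⟩ : A), embeddingAction_apply_apply, starSwap_inv]

lemma starOperator_agreementEmb_of_mem (ho : o ∈ A) (g : A ↪ α) :
    starOperator o (agreementEmb A g) = ∑ g', starBlock o A g' g • agreementEmb A g' +
      agreement (A.erase o) (Function.extend Subtype.val g id) := by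
  rw [agreementEmb, starOperator_agreement_of_mem ho (extend_injOn g id), ← Finset.sum_coe_sort]
  simp only [starBlock, dif_pos ho, Matrix.sum_apply, Finset.sum_smul]
  rw [Finset.sum_comm]
  congr 1
  refine Finset.sum_congr rfl fun l _ => ?_
  rw [sum_permRep_smul]
  exact (agreementEmb_embeddingAction_starSwap ho (Finset.mem_of_mem_erase l.2) g).symm

lemma starOperator_agreementEmb_of_notMem (ho : o ∉ A) (g : A ↪ α) :
    starOperator o (agreementEmb A g) = ∑ g', starBlock o A g' g • agreementEmb A g' +
      ∑ l ∈ A, agreement (insert o (A.erase l))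
        (Function.extend Subtype.val g id ∘ starSwap o l) := by
  simp only [starBlock, dif_neg ho, Matrix.smul_apply, Matrix.one_apply, smul_eq_mul, mul_ite,
    mul_one, mul_zero, ite_smul, zero_smul, Finset.sum_ite_eq', Finset.mem_univ, if_true]
  exact starOperator_agreement_of_notMem ho

lemma starOperator_agreementEmb_sub_mem (hA : A ≠ Finset.univ) (g : A ↪ α) :
    starOperator o (agreementEmb A g) - ∑ g', starBlock o A g' g • agreementEmb A g' ∈
      agreementsBelow o (starRank o A) := by
  by_cases ho : o ∈ A
  · rw [starOperator_agreementEmb_of_mem ho, add_sub_cancel_left]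
    refine agreement_mem_agreementsBelow (fun h => Finset.notMem_erase o A (h ▸ Finset.mem_univ o))
      ((extend_injOn g id).mono (Finset.erase_subset o A)) ?_
    have hpos : 0 < A.card := Finset.card_pos.2 ⟨o, ho⟩
    simp only [starRank, Finset.card_erase_of_mem ho, Finset.notMem_erase, ho, if_true, if_false]
    omega
  · rw [starOperator_agreementEmb_of_notMem ho, add_sub_cancel_left]
    refine Submodule.sum_mem _ fun l hl => ?_
    have hcard : (insert o (A.erase l)).card = A.card := by
      rw [Finset.card_insert_of_notMem fun h => ho (Finset.mem_of_mem_erase h),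
        Finset.card_erase_add_one hl]
    have hinj : Set.InjOn (Function.extend Subtype.val g id ∘ starSwap o l)
        (insert o (A.erase l) : Finset α) := by
      refine (extend_injOn g id).comp (starSwap o l).injective.injOn fun a ha => ?_
      simp only [starSwap, Equiv.swap_apply_def]
      grind
    refine agreement_mem_agreementsBelow (fun h => hA ?_) hinj ?_
    · rw [← Finset.card_eq_iff_eq_univ, ← hcard, h, Finset.card_univ]
    · simp only [starRank, hcard, Finset.mem_insert_self, ho, if_true, if_false]
      omega

/- A permutation is determined by the preimages of all points but one. -/
lemma agreement_erase_inv (π : Equiv.Perm α) :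
    agreement (Finset.univ.erase o) (π⁻¹ : Equiv.Perm α) = EuclideanSpace.single π 1 := by
  ext σ
  rw [agreement_apply, PiLp.single_apply]
  refine if_congr ⟨fun h => ?_, by rintro rfl; simp⟩ rfl rfl
  have hfix : ∀ a ≠ o, (σ * π⁻¹) a = a := fun a ha => h a (by simp [ha])
  have hinj := (σ * π⁻¹).injective
  have ho : (σ * π⁻¹) o = o := by
    by_contra hne
    exact hne (hinj (hfix _ hne))
  refine mul_inv_eq_one.1 (Equiv.ext fun a => ?_)
  rcases eq_or_ne a o with rfl | ha
  exacts [ho, hfix a ha]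

lemma iSup_span_agreementEmb_eq_top (o : α) :
    ⨆ A : {A : Finset α // A ≠ Finset.univ}, Submodule.span ℝ (Set.range (agreementEmb A.1)) =
      ⊤ := by
  rw [eq_top_iff, ← (EuclideanSpace.basisFun (Equiv.Perm α) ℝ).toBasis.span_eq,
    Submodule.span_le]
  rintro _ ⟨π, rfl⟩
  have hne : Finset.univ.erase o ≠ Finset.univ := fun h =>
    Finset.notMem_erase o _ (h ▸ Finset.mem_univ o)
  have hinj : Set.InjOn (π⁻¹ : Equiv.Perm α) (Finset.univ.erase o : Finset α) :=
    (π⁻¹ : Equiv.Perm α).injective.injOn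
  rw [SetLike.mem_coe, OrthonormalBasis.coe_toBasis, EuclideanSpace.basisFun_apply,
    ← agreement_erase_inv (o := o), ← agreementEmb_of_injOn hinj]
  exact Submodule.mem_iSup_of_mem ⟨_, hne⟩ (Submodule.subset_span ⟨_, rfl⟩)

lemma factorial_mul_closedWords_starSwap_le (o : α) (k : ℕ) :
    ((Fintype.card α).factorial : ℝ) * closedWords (starSwap o) (2 * k) ≤
      ∑ A : {A : Finset α // A ≠ Finset.univ}, (starBlock o A.1 ^ (2 * k)).trace := by
  rw [← trace_starOperator_pow]
  exact trace_even_pow_le_sum_of_triangular (starOperator_isSymmetric o) (fun _ => starBlock_isSymm)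
    (iSup_span_agreementEmb_eq_top o) (fun A g => starOperator_agreementEmb_sub_mem A.2 g) k

end StarTranspositions

section ClosedWordBound

variable {α : Type*} [Fintype α] [DecidableEq α] {o : α} {A : Finset α} {n b : ℕ}

lemma sub_pow_le_pow_mul_exp (hb : b ≤ n) (p : ℕ) :
    ((n : ℝ) - b) ^ p ≤ n ^ p * Real.exp (-(p / n)) ^ b := by
  rcases n.eq_zero_or_pos with rfl | hn
  · obtain rfl := Nat.le_zero.1 hb
    simp
  have hn' : (n : ℝ) ≠ 0 := Nat.cast_ne_zero.2 hn.ne'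
  have hbase : (n : ℝ) - b ≤ n * Real.exp (-(b / n)) := by
    calc (n : ℝ) - b = n * (1 - b / n) := by rw [mul_sub, mul_one, mul_div_cancel₀ _ hn']
      _ ≤ n * Real.exp (-(b / n)) := by gcongr; exact Real.one_sub_le_exp_neg _
  calc ((n : ℝ) - b) ^ p ≤ (n * Real.exp (-(b / n))) ^ p :=
        pow_le_pow_left₀ (sub_nonneg.2 (Nat.cast_le.2 hb)) hbase p
    _ = n ^ p * Real.exp (-(p / n)) ^ b := by
        rw [mul_pow, ← Real.exp_nat_mul, ← Real.exp_nat_mul]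
        ring_nf

lemma trace_starBlock_pow_le_of_notMem (h : o ∉ A) (p : ℕ) (hn : Fintype.card α = n) :
    (starBlock o A ^ p).trace ≤ n ^ p * (n * Real.exp (-(p / n))) ^ A.card := by
  have hA : A.card ≤ n := hn ▸ A.card_le_univ
  calc (starBlock o A ^ p).trace = n.descFactorial A.card * ((n : ℝ) - A.card) ^ p := by
        rw [trace_starBlock_pow_of_notMem h, hn]
    _ ≤ n ^ A.card * (n ^ p * Real.exp (-(p / n)) ^ A.card) := by
        gcongr
        · exact pow_nonneg (sub_nonneg.2 (Nat.cast_le.2 hA)) p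
        · exact_mod_cast n.descFactorial_le_pow A.card
        · exact sub_pow_le_pow_mul_exp hA p
    _ = n ^ p * (n * Real.exp (-(p / n))) ^ A.card := by rw [mul_pow]; ring

lemma trace_starBlock_pow_le_of_closedWords_le (h : o ∈ A) {p : ℕ} {c : ℝ}
    (hc : A.card.factorial * closedWords (starSwap (⟨o, h⟩ : A)) p ≤ c * A.card ^ p) (hc₀ : 0 ≤ c)
    (hn : Fintype.card α = n) :
    (starBlock o A ^ p).trace ≤ c * n ^ p * (n * Real.exp (-(p / n))) ^ (n - A.card) := by
  have hA : A.card ≤ n := hn ▸ A.card_le_univ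
  have hchoose : (n.choose A.card : ℝ) ≤ n ^ (n - A.card) := by
    rw [← Nat.choose_symm hA]
    exact_mod_cast n.choose_le_pow (n - A.card)
  have hpow : (A.card : ℝ) ^ p ≤ n ^ p * Real.exp (-(p / n)) ^ (n - A.card) := by
    have hsub := sub_pow_le_pow_mul_exp (Nat.sub_le n A.card) p
    rwa [Nat.cast_sub hA, sub_sub_cancel] at hsub
  calc (starBlock o A ^ p).trace
      ≤ n.descFactorial A.card * closedWords (starSwap (⟨o, h⟩ : A)) p :=
        hn ▸ trace_starBlock_pow_le_of_mem h p
    _ = n.choose A.card * (A.card.factorial * closedWords (starSwap (⟨o, h⟩ : A)) p) := by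
        rw [Nat.descFactorial_eq_factorial_mul_choose, Nat.cast_mul]
        ring
    _ ≤ n ^ (n - A.card) * (c * (n ^ p * Real.exp (-(p / n)) ^ (n - A.card))) :=
        mul_le_mul hchoose (hc.trans (by gcongr)) (by positivity) (by positivity)
    _ = c * n ^ p * (n * Real.exp (-(p / n))) ^ (n - A.card) := by rw [mul_pow]; ring

lemma sum_ne_univ_pow_card_le {x : ℝ} (hx : 0 ≤ x) (hn : Fintype.card α = n) :
    ∑ A : {A : Finset α // A ≠ Finset.univ}, (x ^ A.1.card + 2 * x ^ (n - A.1.card)) ≤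
      3 * Real.exp (n * x) - 2 := by
  have hbinom (y : ℝ) (hy : 0 ≤ y) : (y + 1) ^ n ≤ Real.exp (n * y) := by
    rw [Real.exp_nat_mul]
    gcongr
    exact Real.add_one_le_exp y
  have hcard : ∑ A : Finset α, x ^ A.card = (x + 1) ^ n := by
    simpa [hn] using Fintype.sum_pow_mul_eq_add_pow α x 1
  have hcompl : ∑ A : Finset α, x ^ (n - A.card) = (x + 1) ^ n := by
    simpa [hn, add_comm] using Fintype.sum_pow_mul_eq_add_pow α 1 x
  calc ∑ A : {A : Finset α // A ≠ Finset.univ}, (x ^ A.1.card + 2 * x ^ (n - A.1.card))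
      = ∑ A ∈ Finset.univ.erase (Finset.univ : Finset α), (x ^ A.card + 2 * x ^ (n - A.card)) :=
        (Finset.sum_subtype _ (fun A => by rw [Finset.mem_erase, and_iff_left (Finset.mem_univ A)])
          fun A : Finset α => x ^ A.card + 2 * x ^ (n - A.card)).symm
    _ = 3 * (x + 1) ^ n - (x ^ n + 2) := by
        rw [Finset.sum_erase_eq_sub (Finset.mem_univ _), Finset.sum_add_distrib, ← Finset.mul_sum,
          hcard, hcompl, Finset.card_univ, hn, Nat.sub_self, pow_zero]
        ring
    _ ≤ 3 * Real.exp (n * x) - 2 := by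
        linarith [hbinom x hx, pow_nonneg hx n]

lemma three_mul_exp_sub_two_le {q : ℝ} (h₀ : 0 ≤ q) (h₁ : q ≤ 1 / 4) :
    3 * Real.exp q - 2 ≤ 1 + 4 * q := by
  have hexp := (abs_le.1 (Real.abs_exp_sub_one_sub_id_le (x := q)
    (by rw [abs_of_nonneg h₀]; linarith))).2
  nlinarith

/- Strong induction on `n`: the blocks of the sets containing `o` are star operators on fewer
points. -/
theorem factorial_mul_closedWords_starSwap_le_pow (o : α) (k : ℕ) (hn : Fintype.card α = n)
    (hq : (n : ℝ) ^ 2 * Real.exp (-((2 * k : ℕ) / n)) ≤ 1 / 4) :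
    n.factorial * closedWords (starSwap o) (2 * k) ≤
      (1 + 4 * (n ^ 2 * Real.exp (-((2 * k : ℕ) / n)))) * (n : ℝ) ^ (2 * k) := by
  induction n using Nat.strong_induction_on generalizing α with
  | _ n ih =>
    set p := 2 * k
    set x := (n : ℝ) * Real.exp (-(p / n)) with hx
    have hnx : (n : ℝ) ^ 2 * Real.exp (-(p / n)) = n * x := by rw [hx]; ring
    have hterm (A : {A : Finset α // A ≠ Finset.univ}) : (starBlock o A.1 ^ p).trace ≤
        n ^ p * (x ^ A.1.card + 2 * x ^ (n - A.1.card)) := by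
      obtain ⟨A, hA⟩ := A
      by_cases h : o ∈ A
      · have hlt : A.card < n := hn ▸ (Finset.card_lt_iff_ne_univ A).2 hA
        have hpos : 0 < A.card := Finset.card_pos.2 ⟨o, h⟩
        have hqA : (A.card : ℝ) ^ 2 * Real.exp (-(p / A.card)) ≤ 1 / 4 :=
          le_trans (by gcongr) hq
        have hclosed : A.card.factorial * closedWords (starSwap (⟨o, h⟩ : A)) p ≤
            2 * (A.card : ℝ) ^ p :=
          (ih A.card hlt (⟨o, h⟩ : A) (Fintype.card_coe A) hqA).trans (by gcongr; linarith)
        have hpow : 0 ≤ (n : ℝ) ^ p * x ^ A.card := by positivity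
        linarith [trace_starBlock_pow_le_of_closedWords_le h hclosed zero_le_two hn]
      · have hpow : 0 ≤ (n : ℝ) ^ p * x ^ (n - A.card) := by positivity
        linarith [trace_starBlock_pow_le_of_notMem h p hn]
    calc n.factorial * closedWords (starSwap o) p
        ≤ ∑ A : {A : Finset α // A ≠ Finset.univ}, (starBlock o A.1 ^ p).trace :=
          hn ▸ factorial_mul_closedWords_starSwap_le o k
      _ ≤ n ^ p * ∑ A : {A : Finset α // A ≠ Finset.univ},
            (x ^ A.1.card + 2 * x ^ (n - A.1.card)) := by
          rw [Finset.mul_sum]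
          exact Finset.sum_le_sum fun A _ => hterm A
      _ ≤ n ^ p * (1 + 4 * (n * x)) := by
          gcongr
          exact (sum_ne_univ_pow_card_le (by positivity) hn).trans
            (three_mul_exp_sub_two_le (by positivity) (hnx ▸ hq))
      _ = (1 + 4 * (n ^ 2 * Real.exp (-(p / n)))) * (n : ℝ) ^ p := by rw [hnx, mul_comm]

end ClosedWordBound

section Convolution

variable {Γ : Type*} [Fintype Γ]

/-- The identification of the group algebra with the functions on the group, which turns products
into convolutions. -/
def massFunction : MonoidAlgebra ℝ Γ ≃ₗ[ℝ] (Γ → ℝ) :=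
  MonoidAlgebra.coeffLinearEquiv ℝ ≪≫ₗ Finsupp.linearEquivFunOnFinite ℝ ℝ Γ

lemma massFunction_apply (m : MonoidAlgebra ℝ Γ) (x : Γ) : massFunction m x = m.coeff x := rfl

variable [Group Γ]

lemma sum_conv (p q : Γ → ℝ) : ∑ x, conv p q x = (∑ x, p x) * ∑ x, q x := by
  calc ∑ x, ∑ y, p (x * y⁻¹) * q y
      = ∑ y, ∑ x, p (x * y⁻¹) * q y := Finset.sum_comm
    _ = ∑ y, (∑ x, p x) * q y := Finset.sum_congr rfl fun y _ => by
        rw [← Finset.sum_mul, ← Equiv.sum_comp (Equiv.mulRight y⁻¹) p]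
        rfl
    _ = (∑ x, p x) * ∑ x, q x := (Finset.mul_sum _ _ _).symm

lemma sum_convPow {p : Γ → ℝ} (hp : ∑ x, p x = 1) (k : ℕ) : ∑ x, convPow p k x = 1 := by
  induction k with
  | zero => classical exact (Finset.sum_ite_eq' _ _ _).trans (if_pos (Finset.mem_univ _))
  | succ k ih => rw [convPow, sum_conv, ih, hp, one_mul]

lemma massFunction_of [DecidableEq Γ] (a x : Γ) :
    massFunction (MonoidAlgebra.of ℝ Γ a) x = if a = x then 1 else 0 := by
  rw [massFunction_apply, MonoidAlgebra.of_apply, MonoidAlgebra.coeff_single,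
    Finsupp.single_apply]

lemma massFunction_sum_of_of_injective {ι : Type*} [Fintype ι] {s : ι → Γ}
    (hs : Function.Injective s) :
    massFunction (∑ i, MonoidAlgebra.of ℝ Γ (s i)) = (Set.range s).indicator 1 := by
  classical
  ext x
  rw [map_sum, Finset.sum_apply]
  simp only [massFunction_of]
  by_cases hx : x ∈ Set.range s
  · obtain ⟨i, rfl⟩ := hx
    simp [hs.eq_iff]
  · rw [Set.indicator_of_notMem hx]
    exact Finset.sum_eq_zero fun i _ => if_neg fun hi => hx ⟨i, hi⟩

lemma massFunction_mul (m m' : MonoidAlgebra ℝ Γ) :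
    massFunction (m * m') = conv (massFunction m) (massFunction m') := by
  ext x
  rw [massFunction_apply, MonoidAlgebra.coeff_mul_apply_right, Finsupp.sum_fintype _ _ (by simp)]
  rfl

lemma massFunction_pow (m : MonoidAlgebra ℝ Γ) (k : ℕ) :
    massFunction (m ^ k) = convPow (massFunction m) k := by
  classical
  induction k with
  | zero =>
    ext x
    rw [pow_zero, ← map_one (MonoidAlgebra.of ℝ Γ), massFunction_of, convPow]
    simp only [eq_comm]
  | succ k ih => rw [pow_succ, massFunction_mul, ih, convPow]

lemma convPow_add (p : Γ → ℝ) (j k : ℕ) :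
    convPow p (j + k) = conv (convPow p j) (convPow p k) := by
  obtain ⟨m, rfl⟩ := massFunction.surjective p
  simp only [← massFunction_pow, ← massFunction_mul, pow_add]

lemma convPow_massFunction_smul_sum {ι : Type*} [Fintype ι] (c : ℝ) (s : ι → MonoidAlgebra ℝ Γ)
    (k : ℕ) :
    convPow (massFunction (c • ∑ i, s i)) k =
      c ^ k • ∑ w : Fin k → ι, massFunction (List.ofFn fun j => s (w j)).prod := by
  rw [← massFunction_pow, smul_pow, sum_pow_eq_sum_prod_ofFn, map_smul, map_sum]

lemma convPow_massFunction_smul_sum_of_one {ι : Type*} [Fintype ι] (c : ℝ) (s : ι → Γ) (k : ℕ) :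
    convPow (massFunction (c • ∑ i, MonoidAlgebra.of ℝ Γ (s i))) k 1 =
      c ^ k * closedWords s k := by
  classical
  rw [convPow_massFunction_smul_sum, Pi.smul_apply, Finset.sum_apply, smul_eq_mul, closedWords,
    Finset.card_filter, Nat.cast_sum]
  congr 1
  refine Finset.sum_congr rfl fun w _ => ?_
  have hprod : (List.ofFn fun j => MonoidAlgebra.of ℝ Γ (s (w j))).prod =
      MonoidAlgebra.of ℝ Γ (List.ofFn fun j => s (w j)).prod := by
    rw [map_list_prod, List.map_ofFn]
    rfl
  rw [hprod, massFunction_of, Nat.cast_ite, Nat.cast_one, Nat.cast_zero]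

variable {p q : Γ → ℝ}

lemma conv_inv (hp : ∀ x, p x⁻¹ = p x) (hq : ∀ x, q x⁻¹ = q x) (x : Γ) :
    conv p q x⁻¹ = conv q p x := by
  refine Fintype.sum_equiv (Equiv.mulRight x) _ _ fun y => ?_
  rw [Equiv.coe_mulRight, mul_inv_rev, mul_inv_cancel_left, hq, ← mul_inv_rev, hp, mul_comm]

lemma convPow_inv (hp : ∀ x, p x⁻¹ = p x) (k : ℕ) (x : Γ) : convPow p k x⁻¹ = convPow p k x := by
  induction k generalizing x with
  | zero => classical exact if_congr inv_eq_one rfl rfl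
  | succ k ih =>
    have hone : convPow p 1 = p := by
      obtain ⟨m, rfl⟩ := massFunction.surjective p
      rw [← massFunction_pow, pow_one]
    calc convPow p (k + 1) x⁻¹ = conv p (convPow p k) x := conv_inv ih hp x
      _ = convPow p (k + 1) x := by rw [add_comm, convPow_add, hone]

lemma convPow_two_mul_one (hp : ∀ x, p x⁻¹ = p x) (k : ℕ) :
    convPow p (2 * k) 1 = ∑ x, convPow p k x ^ 2 := by
  rw [two_mul, convPow_add, conv]
  simp only [one_mul, convPow_inv hp, sq]

/- The Cauchy–Schwarz inequality together with the `ℓ²`-distance to the uniform distribution, which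
is read off the return probability `p^{*2k}(1)`. -/
lemma sq_sum_abs_convPow_sub_uniform_le (hsum : ∑ x, p x = 1) (hp : ∀ x, p x⁻¹ = p x) (k : ℕ) :
    (∑ x, |convPow p k x - uniform Γ x|) ^ 2 ≤ Fintype.card Γ * convPow p (2 * k) 1 - 1 := by
  have hcard : (Fintype.card Γ : ℝ) ≠ 0 := Nat.cast_ne_zero.2 Fintype.card_ne_zero
  have hsq : ∑ x, (convPow p k x - uniform Γ x) ^ 2 =
      convPow p (2 * k) 1 - 1 / Fintype.card Γ := by
    simp only [sub_sq, uniform, Finset.sum_add_distrib, Finset.sum_sub_distrib, ← Finset.sum_mul,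
      ← Finset.mul_sum, sum_convPow hsum, ← convPow_two_mul_one hp, Finset.sum_const,
      Finset.card_univ, nsmul_eq_mul]
    field_simp
    ring
  calc (∑ x, |convPow p k x - uniform Γ x|) ^ 2
      ≤ Fintype.card Γ * ∑ x, |convPow p k x - uniform Γ x| ^ 2 := sq_sum_le_card_mul_sum_sq
    _ = Fintype.card Γ * convPow p (2 * k) 1 - 1 := by
        simp only [sq_abs, hsq, mul_sub, mul_one_div_cancel hcard]

/-- The probability measures on a finite group, as a submonoid of the group algebra. -/
def probabilitySubmonoid (Γ : Type*) [Group Γ] [Fintype Γ] : Submonoid (MonoidAlgebra ℝ Γ) where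
  carrier := {m | massFunction m ∈ stdSimplex ℝ Γ}
  one_mem' := by
    classical
    simp only [Set.mem_ofPred_eq, ← map_one (MonoidAlgebra.of ℝ Γ), stdSimplex, massFunction_of]
    exact ⟨fun x => by positivity, by simp⟩
  mul_mem' := by
    rintro m m' ⟨hm, hm1⟩ ⟨hm', hm1'⟩
    simp only [Set.mem_ofPred_eq, massFunction_mul]
    exact ⟨fun x => Finset.sum_nonneg fun y _ => mul_nonneg (hm _) (hm' _),
      by rw [sum_conv, hm1, hm1', one_mul]⟩

lemma mem_probabilitySubmonoid {m : MonoidAlgebra ℝ Γ} :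
    m ∈ probabilitySubmonoid Γ ↔ massFunction m ∈ stdSimplex ℝ Γ := Iff.rfl

lemma of_mem_probabilitySubmonoid (a : Γ) : MonoidAlgebra.of ℝ Γ a ∈ probabilitySubmonoid Γ := by
  classical
  simp only [mem_probabilitySubmonoid, stdSimplex, Set.mem_ofPred_eq, massFunction_of]
  exact ⟨fun x => by positivity, by simp⟩

lemma average_mem_probabilitySubmonoid {ι : Type*} [Fintype ι] [Nonempty ι]
    {m : ι → MonoidAlgebra ℝ Γ} (hm : ∀ i, m i ∈ probabilitySubmonoid Γ) :
    (1 / Fintype.card ι : ℝ) • ∑ i, m i ∈ probabilitySubmonoid Γ := by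
  rw [mem_probabilitySubmonoid, map_smul, map_sum, Finset.smul_sum]
  refine (convex_stdSimplex ℝ Γ).sum_mem (fun _ _ => by positivity) ?_ fun i _ => hm i
  rw [Finset.sum_const, Finset.card_univ, nsmul_eq_mul,
    mul_one_div_cancel (Nat.cast_ne_zero.2 Fintype.card_ne_zero)]

end Convolution

section TotalVariation

variable {Ω : Type*} [Fintype Ω] {μ ν : Ω → ℝ}

lemma tvDist_nonneg (μ ν : Ω → ℝ) : 0 ≤ tvDist μ ν := Real.iSup_nonneg fun _ => abs_nonneg _

lemma abs_sum_sub_sum_le_tvDist (μ ν : Ω → ℝ) (A : Finset Ω) :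
    |∑ x ∈ A, μ x - ∑ x ∈ A, ν x| ≤ tvDist μ ν :=
  le_ciSup (f := fun A : Finset Ω => |∑ x ∈ A, μ x - ∑ x ∈ A, ν x|) (Set.finite_range _).bddAbove A

lemma tvDist_le_sum_abs (μ ν : Ω → ℝ) : tvDist μ ν ≤ ∑ x, |μ x - ν x| := by
  refine ciSup_le fun A => ?_
  rw [← Finset.sum_sub_distrib]
  exact (Finset.abs_sum_le_sum_abs _ _).trans
    (Finset.sum_le_univ_sum_of_nonneg fun _ => abs_nonneg _)

lemma tvDist_self (μ : Ω → ℝ) : tvDist μ μ = 0 := by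
  simp only [tvDist, sub_self, abs_zero, ciSup_const]

lemma tvDist_triangle (μ ν ξ : Ω → ℝ) : tvDist μ ξ ≤ tvDist μ ν + tvDist ν ξ :=
  ciSup_le fun A => (abs_sub_le _ (∑ x ∈ A, ν x) _).trans
    (add_le_add (abs_sum_sub_sum_le_tvDist μ ν A) (abs_sum_sub_sum_le_tvDist ν ξ A))

lemma tvDist_smul {c : ℝ} (hc : 0 ≤ c) (μ ν : Ω → ℝ) :
    tvDist (c • μ) (c • ν) = c * tvDist μ ν := by
  simp only [tvDist, Real.mul_iSup_of_nonneg hc, Pi.smul_apply, smul_eq_mul, ← Finset.mul_sum,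
    ← mul_sub, abs_mul, abs_of_nonneg hc]

lemma tvDist_sum_le {ι : Type*} (s : Finset ι) (μ ν : ι → Ω → ℝ) :
    tvDist (∑ i ∈ s, μ i) (∑ i ∈ s, ν i) ≤ ∑ i ∈ s, tvDist (μ i) (ν i) := by
  refine ciSup_le fun A => ?_
  simp only [Finset.sum_apply]
  rw [Finset.sum_comm, Finset.sum_comm (f := fun x i => ν i x), ← Finset.sum_sub_distrib]
  exact (Finset.abs_sum_le_sum_abs _ _).trans
    (Finset.sum_le_sum fun i _ => abs_sum_sub_sum_le_tvDist (μ i) (ν i) A)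

lemma tvDist_le_one (hμ : μ ∈ stdSimplex ℝ Ω) (hν : ν ∈ stdSimplex ℝ Ω) : tvDist μ ν ≤ 1 := by
  have hmass {ξ : Ω → ℝ} (hξ : ξ ∈ stdSimplex ℝ Ω) (A : Finset Ω) :
      ∑ x ∈ A, ξ x ∈ Set.Icc 0 1 :=
    ⟨Finset.sum_nonneg fun x _ => hξ.1 x, hξ.2 ▸ Finset.sum_le_univ_sum_of_nonneg hξ.1⟩
  refine ciSup_le fun A => ?_
  simpa only [sub_zero] using abs_sub_le_of_le_of_le (hmass hμ A).1 (hmass hμ A).2 (hmass hν A).1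
    (hmass hν A).2

end TotalVariation

section TransposeTop

lemma transposeTopMeasure_eq_massFunction (n : ℕ+) :
    transposeTopMeasure n = massFunction
      ((1 / n : ℝ) • ∑ l, MonoidAlgebra.of ℝ (Equiv.Perm (Fin n)) (starSwap (top n) l)) := by
  classical
  ext π
  have hrange : (π = 1 ∨ ∃ i, i ≠ top n ∧ π = Equiv.swap i (top n)) ↔
      π ∈ Set.range (starSwap (top n)) := by
    constructor
    · rintro (rfl | ⟨i, -, rfl⟩)
      · exact ⟨top n, Equiv.swap_self _⟩
      · exact ⟨i, rfl⟩
    · rintro ⟨l, rfl⟩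
      obtain rfl | hl := eq_or_ne l (top n)
      · exact .inl (Equiv.swap_self _)
      · exact .inr ⟨l, hl, rfl⟩
  rw [map_smul, massFunction_sum_of_of_injective (starSwap_injective _), transposeTopMeasure,
    Pi.smul_apply, Set.indicator_apply, smul_eq_mul, Pi.one_apply, mul_ite, mul_one, mul_zero]
  exact if_congr hrange rfl rfl

lemma sum_transposeTopMeasure (n : ℕ+) : ∑ π, transposeTopMeasure n π = 1 := by
  have : Nonempty (Fin n) := ⟨top n⟩
  have h := average_mem_probabilitySubmonoid fun l =>
    of_mem_probabilitySubmonoid (starSwap (top n) l)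
  rw [Fintype.card_fin] at h
  rw [transposeTopMeasure_eq_massFunction]
  exact h.2

lemma transposeTopMeasure_inv (n : ℕ+) (π : Equiv.Perm (Fin n)) :
    transposeTopMeasure n π⁻¹ = transposeTopMeasure n π := by
  simp only [transposeTopMeasure, inv_eq_iff_eq_inv, inv_one, Equiv.swap_inv]

lemma sum_abs_convPow_transposeTopMeasure_sub_uniform_le {n : ℕ+} {k : ℕ}
    (hk : n * Real.exp (-(k / n)) ≤ 1 / 2) :
    ∑ π, |convPow (transposeTopMeasure n) k π - uniform (Equiv.Perm (Fin n)) π| ≤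
      2 * (n * Real.exp (-(k / n))) := by
  set x : ℝ := n * Real.exp (-(k / n)) with hx
  have hx₀ : 0 ≤ x := by positivity
  have hxsq : (n : ℝ) ^ 2 * Real.exp (-((2 * k : ℕ) / n)) = x ^ 2 := by
    rw [hx, mul_pow, ← Real.exp_nat_mul]
    push_cast
    ring_nf
  have hreturn : n.val.factorial * convPow (transposeTopMeasure n) (2 * k) 1 ≤ 1 + 4 * x ^ 2 := by
    rw [transposeTopMeasure_eq_massFunction, convPow_massFunction_smul_sum_of_one, one_div, inv_pow,
      mul_left_comm, inv_mul_le_iff₀ (by positivity), mul_comm _ (1 + _), ← hxsq]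
    exact factorial_mul_closedWords_starSwap_le_pow (top n) k (Fintype.card_fin n)
      (by rw [hxsq]; nlinarith)
  have hl2 := sq_sum_abs_convPow_sub_uniform_le (sum_transposeTopMeasure n)
    (transposeTopMeasure_inv n) k
  rw [Fintype.card_perm, Fintype.card_fin] at hl2
  refine le_of_sq_le_sq ?_ (by positivity)
  linarith

lemma mul_exp_neg_div_le {n : ℕ+} {C k : ℝ} (hk : n * Real.log n + C * n ≤ k) :
    n * Real.exp (-(k / n)) ≤ Real.exp (-C) := by
  have hn : (0 : ℝ) < n := Nat.cast_pos.2 n.pos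
  have hdiv : Real.log n + C ≤ k / n := by
    rw [le_div_iff₀ hn]
    linarith
  calc n * Real.exp (-(k / n)) = Real.exp (Real.log n - k / n) := by
        rw [sub_eq_add_neg, Real.exp_add, Real.exp_log hn]
    _ ≤ Real.exp (-C) := Real.exp_le_exp.2 (by linarith)

lemma exp_neg_le_half {C : ℝ} (hC : 1 ≤ C) : Real.exp (-C) ≤ 1 / 2 := by
  have hexp : 2 ≤ Real.exp C := by linarith [Real.add_one_le_exp C]
  rw [Real.exp_neg, ← one_div]
  exact one_div_le_one_div_of_le two_pos hexp

theorem tvDist_convPow_transposeTopMeasure_uniform_le {n : ℕ+} {C : ℝ} (hC : 1 ≤ C) {k : ℕ}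
    (hk : n * Real.log n + C * n ≤ k) :
    tvDist (convPow (transposeTopMeasure n) k) (uniform (Equiv.Perm (Fin n))) ≤
      2 * Real.exp (-C) := by
  have hexp := mul_exp_neg_div_le hk
  have hl1 := sum_abs_convPow_transposeTopMeasure_sub_uniform_le (hexp.trans (exp_neg_le_half hC))
  linarith [tvDist_le_sum_abs (convPow (transposeTopMeasure n) k) (uniform _)]

end TransposeTop

section GroupAverage

variable {G A : Type*} [Group G] [Fintype G] [Ring A] [Algebra ℝ A] (φ : G →* A)

/-- The average of the values of a representation of a finite group. -/
def groupAvg : A := (1 / Fintype.card G : ℝ) • ∑ g, φ g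

variable {φ}

lemma average_const (a : A) : (1 / Fintype.card G : ℝ) • ∑ _g : G, a = a := by
  rw [Finset.sum_const, Finset.card_univ, ← Nat.cast_smul_eq_nsmul ℝ, smul_smul,
    one_div_mul_cancel (Nat.cast_ne_zero.2 Fintype.card_ne_zero), one_smul]

lemma map_mul_groupAvg (g : G) : φ g * groupAvg φ = groupAvg φ := by
  simp only [groupAvg, mul_smul_comm, Finset.mul_sum, ← map_mul]
  rw [← Equiv.sum_comp (Equiv.mulLeft g) fun h => φ h]
  rfl

lemma groupAvg_mul_map (g : G) : groupAvg φ * φ g = groupAvg φ := by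
  simp only [groupAvg, smul_mul_assoc, Finset.sum_mul, ← map_mul]
  rw [← Equiv.sum_comp (Equiv.mulRight g) fun h => φ h]
  rfl

lemma average_map_inv : (1 / Fintype.card G : ℝ) • ∑ g, φ g⁻¹ = groupAvg φ := by
  rw [groupAvg, ← Equiv.sum_comp (Equiv.inv G) fun g => φ g]
  rfl

lemma groupAvg_mul_eq_self {a : A} (h : ∀ g, φ g * a = a) : groupAvg φ * a = a := by
  simp only [groupAvg, smul_mul_assoc, Finset.sum_mul, h, average_const]

end GroupAverage

section WreathProduct

variable {n : ℕ} {G : Type*} [Group G]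

/-- The base group `G^n` inside the group algebra of `G ≀ S_n`. -/
def baseAlg : (Fin n → G) →* MonoidAlgebra ℝ (MonomialGroup n G) :=
  (MonoidAlgebra.of ℝ _).comp SemidirectProduct.inl

/-- The factor of the base group at position `x` inside the group algebra of `G ≀ S_n`. -/
def coordAlg (x : Fin n) : G →* MonoidAlgebra ℝ (MonomialGroup n G) :=
  baseAlg.comp (MonoidHom.mulSingle (fun _ => G) x)

/-- The permutations inside the group algebra of `G ≀ S_n`. -/
def permAlg : Equiv.Perm (Fin n) →* MonoidAlgebra ℝ (MonomialGroup n G) :=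
  (MonoidAlgebra.of ℝ _).comp SemidirectProduct.inr

lemma of_mk (h : Fin n → G) (σ : Equiv.Perm (Fin n)) :
    MonoidAlgebra.of ℝ (MonomialGroup n G) ⟨h, σ⟩ = baseAlg h * permAlg σ := by
  rw [SemidirectProduct.mk_eq_inl_mul_inr, map_mul]
  rfl

lemma permAlg_mul_baseAlg (σ : Equiv.Perm (Fin n)) (h : Fin n → G) :
    permAlg σ * baseAlg h = baseAlg (permAut n G σ h) * permAlg σ := by
  simp only [permAlg, baseAlg, MonoidHom.comp_apply, ← map_mul, SemidirectProduct.inl_aut, map_inv,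
    inv_mul_cancel_right]

lemma permAlg_mul_coordAlg (σ : Equiv.Perm (Fin n)) (x : Fin n) (g : G) :
    permAlg σ * coordAlg x g = coordAlg (σ x) g * permAlg σ := by
  have hsingle : permAut n G σ (Pi.mulSingle x g) = Pi.mulSingle (σ x) g := by
    ext i
    change (Pi.mulSingle x g : Fin n → G) (σ⁻¹ i) = _
    simp only [Pi.mulSingle_apply, Equiv.Perm.inv_eq_iff_eq]
  change permAlg σ * baseAlg (Pi.mulSingle x g) = baseAlg (Pi.mulSingle (σ x) g) * permAlg σ
  rw [permAlg_mul_baseAlg, hsingle]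

lemma coordAlg_commute {x y : Fin n} (hxy : x ≠ y) (g h : G) :
    Commute (coordAlg x g) (coordAlg y h) :=
  (Pi.mulSingle_commute (f := fun _ => G) hxy g h).map baseAlg

/-- Invariance of an element of the group algebra under left multiplication by the factor of the
base group at position `x`. -/
def InvariantAt (x : Fin n) (m : MonoidAlgebra ℝ (MonomialGroup n G)) : Prop :=
  ∀ g, coordAlg x g * m = m

variable {x y : Fin n} {m : MonoidAlgebra ℝ (MonomialGroup n G)}

lemma InvariantAt.permAlg_mul (h : InvariantAt x m) (σ : Equiv.Perm (Fin n)) :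
    InvariantAt (σ x) (permAlg σ * m) := fun g => by
  rw [← mul_assoc, ← permAlg_mul_coordAlg, mul_assoc, h]

lemma baseAlg_mul_eq_self_of_forall_invariantAt (hm : ∀ x, InvariantAt x m) (h : Fin n → G) :
    baseAlg h * m = m := by
  let fixing : Submonoid (Fin n → G) :=
    { carrier := {h | baseAlg h * m = m}
      one_mem' := by rw [Set.mem_ofPred_eq, map_one, one_mul]
      mul_mem' := fun {h h'} hh hh' => by
        rw [Set.mem_ofPred_eq] at hh hh' ⊢
        rw [map_mul, mul_assoc, hh', hh] }
  exact Submonoid.pi_mem_of_mulSingle_mem (H := fixing) h fun x => hm x (h x)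

variable [Fintype G]

lemma invariantAt_groupAvg_mul (x : Fin n) (m : MonoidAlgebra ℝ (MonomialGroup n G)) :
    InvariantAt x (groupAvg (coordAlg x) * m) := fun g => by
  rw [← mul_assoc, map_mul_groupAvg]

lemma InvariantAt.groupAvg_mul (h : InvariantAt x m) (y : Fin n) :
    InvariantAt x (groupAvg (coordAlg y) * m) := by
  obtain rfl | hxy := eq_or_ne x y
  · exact invariantAt_groupAvg_mul x m
  · intro g
    have hcomm : Commute (coordAlg x g) (groupAvg (coordAlg y)) :=
      (Commute.sum_right _ _ _ fun g' _ => coordAlg_commute hxy g g').smul_right _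
    rw [hcomm.left_comm, h]

lemma permAlg_commute_groupAvg_baseAlg (σ : Equiv.Perm (Fin n)) :
    Commute (permAlg σ) (groupAvg (baseAlg : (Fin n → G) →* _)) := by
  rw [Commute, SemiconjBy, groupAvg, mul_smul_comm, smul_mul_assoc, Finset.mul_sum, Finset.sum_mul,
    ← Equiv.sum_comp (permAut n G σ).toEquiv fun h => baseAlg h * permAlg σ]
  simp only [permAlg_mul_baseAlg]
  rfl

lemma groupAvg_baseAlg_mul_of (y : MonomialGroup n G) :
    groupAvg (baseAlg : (Fin n → G) →* _) * MonoidAlgebra.of ℝ _ y =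
      groupAvg baseAlg * permAlg y.right := by
  obtain ⟨h, σ⟩ := y
  rw [of_mk, ← mul_assoc, groupAvg_mul_map]

variable (G) in
/-- The lift of a measure on `S_n` to `G ≀ S_n` that is uniform along the cosets of the base
group. -/
def fibreLift : (Equiv.Perm (Fin n) → ℝ) →ₗ[ℝ] (MonomialGroup n G → ℝ) :=
  (1 / Fintype.card (Fin n → G) : ℝ) • LinearMap.funLeft ℝ ℝ SemidirectProduct.right

lemma fibreLift_apply (f : Equiv.Perm (Fin n) → ℝ) (y : MonomialGroup n G) :
    fibreLift G f y = 1 / Fintype.card (Fin n → G) * f y.right := rfl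

lemma massFunction_groupAvg_mul_permAlg (σ : Equiv.Perm (Fin n)) :
    massFunction (groupAvg (baseAlg : (Fin n → G) →* _) * permAlg σ) =
      fibreLift G (massFunction (MonoidAlgebra.of ℝ _ σ)) := by
  classical
  have hinj : Function.Injective fun h : Fin n → G => (⟨h, σ⟩ : MonomialGroup n G) :=
    fun h h' heq => congrArg SemidirectProduct.left heq
  ext ⟨h, π⟩
  have hrange : (⟨h, π⟩ : MonomialGroup n G) ∈
      Set.range (fun h : Fin n → G => (⟨h, σ⟩ : MonomialGroup n G)) ↔ σ = π :=
    ⟨fun ⟨_, hy⟩ => congrArg SemidirectProduct.right hy, fun hσ => ⟨h, hσ ▸ rfl⟩⟩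
  rw [groupAvg, smul_mul_assoc, Finset.sum_mul, map_smul, fibreLift_apply, massFunction_of]
  simp only [← of_mk]
  rw [massFunction_sum_of_of_injective hinj, Pi.smul_apply, smul_eq_mul, Set.indicator_apply,
    Pi.one_apply, if_congr hrange rfl rfl]

lemma fibreLift_uniform : fibreLift G (uniform (Equiv.Perm (Fin n))) =
    uniform (MonomialGroup n G) := by
  ext y
  rw [fibreLift_apply, uniform, uniform, one_div_mul_one_div, ← Nat.cast_mul, ← Fintype.card_prod,
    Fintype.card_congr (SemidirectProduct.equivProd (φ := permAut n G))]

lemma sum_abs_fibreLift (f : Equiv.Perm (Fin n) → ℝ) : ∑ y, |fibreLift G f y| = ∑ π, |f π| := by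
  calc ∑ y, |fibreLift G f y|
      = ∑ z : (Fin n → G) × Equiv.Perm (Fin n), 1 / Fintype.card (Fin n → G) * |f z.2| :=
        Fintype.sum_equiv SemidirectProduct.equivProd _ _ fun y => by
          rw [fibreLift_apply, abs_mul, abs_of_nonneg (by positivity)]
          rfl
    _ = (1 / Fintype.card (Fin n → G) : ℝ) • ∑ _h : Fin n → G, ∑ π, |f π| := by
        rw [← Finset.mul_sum, Fintype.sum_prod_type, smul_eq_mul]
    _ = ∑ π, |f π| := average_const _

end WreathProduct

section WarpSteps

variable {n : ℕ+} {G : Type*} [Group G]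

/-- The step of the warp-transpose top with random shuffle at position `l` with group element `g`;
at the top position this is `lastElt n g`. -/
def stepElt (l : Fin n) (g : G) : MonomialGroup n G :=
  if l = top n then lastElt n g else warpElt n l g

lemma stepElt_right (l : Fin n) (g : G) : (stepElt l g).right = starSwap (top n) l := by
  unfold stepElt
  split_ifs with hl
  · exact hl ▸ (Equiv.swap_self _).symm
  · rfl

lemma stepElt_left_top (l : Fin n) (g : G) : (stepElt l g).left (top n) = g := by
  unfold stepElt
  split_ifs with hl
  · exact Pi.mulSingle_eq_same (M := fun _ => G) (top n) g
  · simp [warpElt, Ne.symm hl]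

lemma uncurry_stepElt_injective :
    Function.Injective (Function.uncurry (stepElt : Fin n → G → MonomialGroup n G)) := by
  rintro ⟨l, g⟩ ⟨l', g'⟩ (h : stepElt l g = stepElt l' g')
  have hl : starSwap (top n) l = starSwap (top n) l' := by
    rw [← stepElt_right l g, h, stepElt_right]
  have hg : g = g' := by rw [← stepElt_left_top l g, h, stepElt_left_top]
  rw [starSwap_injective _ hl, hg]

lemma of_stepElt_top (g : G) : MonoidAlgebra.of ℝ _ (stepElt (top n) g) = coordAlg (top n) g := by
  rw [stepElt, if_pos rfl]
  rfl

lemma of_stepElt_of_ne {l : Fin n} (hl : l ≠ top n) (g : G) :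
    MonoidAlgebra.of ℝ _ (stepElt l g) =
      coordAlg (top n) g * permAlg (starSwap (top n) l) * coordAlg (top n) g⁻¹ := by
  have hmk : MonoidAlgebra.of ℝ _ (warpElt n l g) =
      coordAlg l g⁻¹ * coordAlg (top n) g * permAlg (starSwap (top n) l) := by
    rw [warpElt, of_mk, map_mul]
    rfl
  rw [stepElt, if_neg hl, hmk, mul_assoc (coordAlg (top n) g), permAlg_mul_coordAlg, starSwap,
    Equiv.swap_apply_right, ← mul_assoc, (coordAlg_commute hl _ _).eq]

variable [Fintype G]

/-- The distribution of the step at position `l` with a uniformly random group element. -/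
def stepAlg (l : Fin n) : MonoidAlgebra ℝ (MonomialGroup n G) :=
  (1 / Fintype.card G : ℝ) • ∑ g : G, MonoidAlgebra.of ℝ _ (stepElt l g)

lemma stepAlg_top :
    (stepAlg (top n) : MonoidAlgebra ℝ (MonomialGroup n G)) = groupAvg (coordAlg (top n)) := by
  simp only [stepAlg, of_stepElt_top, groupAvg]

lemma groupAvg_mul_stepAlg (l : Fin n) :
    groupAvg (coordAlg (G := G) (top n)) * stepAlg l =
      groupAvg (coordAlg (G := G) (top n)) * permAlg (starSwap (top n) l) *
        groupAvg (coordAlg (G := G) (top n)) := by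
  obtain rfl | hl := eq_or_ne l (top n)
  · rw [stepAlg_top, starSwap, Equiv.swap_self, ← Equiv.Perm.one_def, map_one, mul_one]
  · simp only [stepAlg, of_stepElt_of_ne hl, mul_smul_comm, Finset.mul_sum, ← mul_assoc,
      groupAvg_mul_map]
    rw [← Finset.mul_sum, ← mul_smul_comm, average_map_inv]

lemma stepAlg_mul_groupAvg (l : Fin n) :
    stepAlg l * groupAvg (coordAlg (G := G) (top n)) =
      groupAvg (coordAlg (G := G) (top n)) * permAlg (starSwap (top n) l) *
        groupAvg (coordAlg (G := G) (top n)) := by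
  obtain rfl | hl := eq_or_ne l (top n)
  · rw [stepAlg_top, starSwap, Equiv.swap_self, ← Equiv.Perm.one_def, map_one, mul_one]
  · simp only [stepAlg, of_stepElt_of_ne hl, smul_mul_assoc, Finset.sum_mul, mul_assoc,
      map_mul_groupAvg]
    rw [← Finset.sum_mul, ← smul_mul_assoc, groupAvg]

/-- The distribution of the product of independent random steps at the positions in a word. -/
def wordAlg (w : List (Fin n)) : MonoidAlgebra ℝ (MonomialGroup n G) := (w.map stepAlg).prod

lemma wordAlg_cons (l : Fin n) (w : List (Fin n)) :
    (wordAlg (l :: w) : MonoidAlgebra ℝ (MonomialGroup n G)) = stepAlg l * wordAlg w := by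
  rw [wordAlg, List.map_cons, List.prod_cons, wordAlg]

lemma invariantAt_groupAvg_mul_wordAlg {w : List (Fin n)} {x : Fin n} (hx : x ∈ top n :: w) :
    InvariantAt x
      (groupAvg (coordAlg (top n)) * wordAlg w : MonoidAlgebra ℝ (MonomialGroup n G)) := by
  induction w generalizing x with
  | nil =>
    rw [List.mem_singleton.1 hx]
    exact invariantAt_groupAvg_mul _ _
  | cons l w ih =>
    obtain rfl | hxt := eq_or_ne x (top n)
    · exact invariantAt_groupAvg_mul _ _
    have hmem : starSwap (top n) l x ∈ top n :: w := by
      obtain rfl | hxl := eq_or_ne x l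
      · rw [starSwap, Equiv.swap_apply_left]
        exact List.mem_cons_self
      · rw [starSwap, Equiv.swap_apply_of_ne_of_ne hxl hxt]
        simpa [hxt, hxl] using hx
    rw [wordAlg_cons, ← mul_assoc, groupAvg_mul_stepAlg, mul_assoc, mul_assoc]
    have hperm := (ih hmem).permAlg_mul (starSwap (top n) l)
    rw [starSwap, Equiv.swap_apply_self] at hperm
    exact hperm.groupAvg_mul (top n)

lemma groupAvg_mul_wordAlg {w : List (Fin n)} (hw : top n ∈ w) :
    (groupAvg (coordAlg (top n)) * wordAlg w : MonoidAlgebra ℝ (MonomialGroup n G)) =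
      wordAlg w := by
  induction w with
  | nil => exact absurd hw List.not_mem_nil
  | cons l w ih =>
    rw [wordAlg_cons, ← mul_assoc]
    obtain rfl | hl := eq_or_ne (top n) l
    · rw [stepAlg_top, groupAvg_mul_eq_self map_mul_groupAvg]
    · rw [groupAvg_mul_stepAlg, ← stepAlg_mul_groupAvg, mul_assoc,
        ih (List.mem_of_ne_of_mem hl hw)]

lemma groupAvg_baseAlg_mul_stepAlg (l : Fin n) :
    groupAvg (baseAlg : (Fin n → G) →* _) * stepAlg l =
      groupAvg baseAlg * permAlg (starSwap (top n) l) := by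
  simp only [stepAlg, mul_smul_comm, Finset.mul_sum, groupAvg_baseAlg_mul_of, stepElt_right,
    average_const]

lemma groupAvg_baseAlg_mul_wordAlg (w : List (Fin n)) :
    groupAvg (baseAlg : (Fin n → G) →* _) * wordAlg w =
      groupAvg baseAlg * permAlg (w.map (starSwap (top n))).prod := by
  induction w with
  | nil => rw [wordAlg, List.map_nil, List.map_nil, List.prod_nil, List.prod_nil, map_one]
  | cons l w ih =>
    rw [wordAlg_cons, ← mul_assoc, groupAvg_baseAlg_mul_stepAlg,
      ← (permAlg_commute_groupAvg_baseAlg _).eq, mul_assoc, ih, ← mul_assoc,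
      (permAlg_commute_groupAvg_baseAlg _).eq, mul_assoc, ← map_mul, List.map_cons, List.prod_cons]

lemma massFunction_wordAlg_of_forall_mem {w : List (Fin n)} (hw : ∀ x, x ∈ w) :
    massFunction (wordAlg w) =
      fibreLift G (massFunction (MonoidAlgebra.of ℝ _ (w.map (starSwap (top n))).prod)) := by
  have hinv (x : Fin n) : InvariantAt x (wordAlg w : MonoidAlgebra ℝ (MonomialGroup n G)) :=
    groupAvg_mul_wordAlg (G := G) (hw (top n)) ▸
      invariantAt_groupAvg_mul_wordAlg (List.mem_cons_of_mem _ (hw x))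
  rw [← massFunction_groupAvg_mul_permAlg, ← groupAvg_baseAlg_mul_wordAlg,
    groupAvg_mul_eq_self (baseAlg_mul_eq_self_of_forall_invariantAt hinv)]

lemma wordAlg_mem_probabilitySubmonoid (w : List (Fin n)) :
    wordAlg w ∈ probabilitySubmonoid (MonomialGroup n G) := by
  refine list_prod_mem fun m hm => ?_
  obtain ⟨l, -, rfl⟩ := List.mem_map.1 hm
  exact average_mem_probabilitySubmonoid fun g => of_mem_probabilitySubmonoid _

lemma warpMeasure_eq_massFunction :
    warpMeasure n G = massFunction ((1 / n : ℝ) • ∑ l, stepAlg l) := by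
  classical
  ext y
  have hrange : ((∃ g, y = lastElt n g) ∨ ∃ g i, i ≠ top n ∧ y = warpElt n i g) ↔
      y ∈ Set.range (Function.uncurry (stepElt : Fin n → G → MonomialGroup n G)) := by
    constructor
    · rintro (⟨g, rfl⟩ | ⟨g, i, hi, rfl⟩)
      · exact ⟨(top n, g), if_pos rfl⟩
      · exact ⟨(i, g), if_neg hi⟩
    · rintro ⟨⟨l, g⟩, rfl⟩
      obtain rfl | hl := eq_or_ne l (top n)
      · exact .inl ⟨g, if_pos rfl⟩
      · exact .inr ⟨g, l, hl, if_neg hl⟩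
  have hsum : (1 / n : ℝ) • ∑ l, stepAlg l = (1 / (n * Fintype.card G) : ℝ) •
      ∑ z : Fin n × G, MonoidAlgebra.of ℝ _ (Function.uncurry stepElt z) := by
    simp only [stepAlg, ← Finset.smul_sum, smul_smul, one_div_mul_one_div, Fintype.sum_prod_type,
      Function.uncurry_apply_pair]
  rw [hsum, map_smul, massFunction_sum_of_of_injective uncurry_stepElt_injective, warpMeasure,
    Pi.smul_apply, Set.indicator_apply, smul_eq_mul, Pi.one_apply, mul_ite, mul_one, mul_zero]
  exact if_congr hrange rfl rfl

end WarpSteps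

section WarpMixing

lemma card_not_surjective_le (ι κ : Type*) [Fintype ι] [DecidableEq ι] [Fintype κ]
    [DecidablePred (Function.Surjective : (ι → κ) → Prop)] :
    (Finset.univ.filter fun w : ι → κ => ¬ Function.Surjective w).card ≤
      Fintype.card κ * (Fintype.card κ - 1) ^ Fintype.card ι := by
  classical
  have hsub : (Finset.univ.filter fun w : ι → κ => ¬ Function.Surjective w) ⊆
      Finset.univ.biUnion fun x => Fintype.piFinset fun _ : ι => Finset.univ.erase x := by
    intro w hw
    obtain ⟨x, hx⟩ := not_forall.1 (Finset.mem_filter.1 hw).2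
    simp only [Finset.mem_biUnion, Fintype.mem_piFinset, Finset.mem_erase]
    exact ⟨x, Finset.mem_univ x, fun i => ⟨fun h => hx ⟨i, h⟩, Finset.mem_univ _⟩⟩
  refine (Finset.card_le_card hsub).trans (Finset.card_biUnion_le.trans_eq ?_)
  simp only [Fintype.card_piFinset, Finset.card_erase_of_mem (Finset.mem_univ _),
    Finset.card_univ, Finset.prod_const, Finset.sum_const, smul_eq_mul]

lemma card_not_surjective_div_pow_le (n : ℕ+) (k : ℕ)
    [DecidablePred (Function.Surjective : (Fin k → Fin n) → Prop)] :
    (1 / n : ℝ) ^ k * (Finset.univ.filter fun w : Fin k → Fin n => ¬ Function.Surjective w).card ≤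
      n * Real.exp (-(k / n)) := by
  have hn : (1 : ℝ) ≤ n := Nat.one_le_cast.2 n.pos
  have hcard : ((Finset.univ.filter fun w : Fin k → Fin n => ¬ Function.Surjective w).card : ℝ) ≤
      n * (n - 1) ^ k := by
    have h := card_not_surjective_le (Fin k) (Fin n)
    rw [Fintype.card_fin, Fintype.card_fin] at h
    rw [← Nat.cast_pred n.pos]
    exact_mod_cast h
  calc (1 / n : ℝ) ^ k * (Finset.univ.filter fun w : Fin k → Fin n => ¬ Function.Surjective w).card
      ≤ (1 / n : ℝ) ^ k * (n * (n - 1) ^ k) := by gcongr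
    _ = n * (1 - 1 / n) ^ k := by
        rw [mul_left_comm, ← mul_pow, mul_sub, one_div_mul_cancel (by positivity), mul_one]
    _ ≤ n * Real.exp (-(1 / n)) ^ k := by
        gcongr
        · exact sub_nonneg.2 ((div_le_one (by positivity)).2 hn)
        · exact Real.one_sub_le_exp_neg _
    _ = n * Real.exp (-(k / n)) := by
        rw [← Real.exp_nat_mul, mul_neg, mul_one_div]

variable {n : ℕ+} {G : Type*} [Group G] [Fintype G]

lemma convPow_warpMeasure (k : ℕ) :
    convPow (warpMeasure n G) k =
      (1 / n : ℝ) ^ k • ∑ w : Fin k → Fin n, massFunction (wordAlg (List.ofFn w)) := by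
  simp only [warpMeasure_eq_massFunction, convPow_massFunction_smul_sum, wordAlg, List.map_ofFn]
  rfl

lemma fibreLift_convPow_transposeTopMeasure (k : ℕ) :
    fibreLift G (convPow (transposeTopMeasure n) k) =
      (1 / n : ℝ) ^ k • ∑ w : Fin k → Fin n, fibreLift G
        (massFunction (MonoidAlgebra.of ℝ _ ((List.ofFn w).map (starSwap (top n))).prod)) := by
  rw [transposeTopMeasure_eq_massFunction, convPow_massFunction_smul_sum]
  simp only [map_smul, map_sum, map_list_prod, List.map_ofFn]
  rfl

lemma fibreLift_massFunction_of_mem_stdSimplex (σ : Equiv.Perm (Fin n)) :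
    fibreLift G (massFunction (MonoidAlgebra.of ℝ _ σ)) ∈ stdSimplex ℝ (MonomialGroup n G) := by
  classical
  rw [← massFunction_groupAvg_mul_permAlg, ← mem_probabilitySubmonoid]
  exact mul_mem
    (average_mem_probabilitySubmonoid fun _ : Fin n → G => of_mem_probabilitySubmonoid _)
    (of_mem_probabilitySubmonoid _)

/- The step words that visit every position contribute equally to both sides, so the distance is at
most the probability that the coupon collector has not finished. -/
lemma tvDist_convPow_warpMeasure_fibreLift_le (k : ℕ) :
    tvDist (convPow (warpMeasure n G) k) (fibreLift G (convPow (transposeTopMeasure n) k)) ≤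
      n * Real.exp (-(k / n)) := by
  classical
  have hword (w : Fin k → Fin n) : tvDist (massFunction (wordAlg (List.ofFn w))) (fibreLift G
      (massFunction (MonoidAlgebra.of ℝ _ ((List.ofFn w).map (starSwap (top n))).prod))) ≤
        if ¬ Function.Surjective w then 1 else 0 := by
    split_ifs with hw
    · rw [massFunction_wordAlg_of_forall_mem fun x => (List.mem_ofFn' _ _).2 (hw x), tvDist_self]
    · exact tvDist_le_one (wordAlg_mem_probabilitySubmonoid _)
        (fibreLift_massFunction_of_mem_stdSimplex _)
  rw [convPow_warpMeasure, fibreLift_convPow_transposeTopMeasure, tvDist_smul (by positivity)]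
  refine le_trans ?_ (card_not_surjective_div_pow_le n k)
  rw [Finset.card_filter, Nat.cast_sum]
  gcongr
  refine (tvDist_sum_le _ _ _).trans (Finset.sum_le_sum fun w _ => ?_)
  exact_mod_cast hword w

theorem tvDist_convPow_warpMeasure_uniform_le {k : ℕ} (hk : n * Real.exp (-(k / n)) ≤ 1 / 2) :
    tvDist (convPow (warpMeasure n G) k) (uniform (MonomialGroup n G)) ≤
      3 * (n * Real.exp (-(k / n))) := by
  have hlift : tvDist (fibreLift G (convPow (transposeTopMeasure n) k))
      (uniform (MonomialGroup n G)) ≤ 2 * (n * Real.exp (-(k / n))) := by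
    calc tvDist (fibreLift G (convPow (transposeTopMeasure n) k)) (uniform (MonomialGroup n G))
        ≤ ∑ y, |fibreLift G
            (convPow (transposeTopMeasure n) k - uniform (Equiv.Perm (Fin n))) y| := by
          rw [map_sub, fibreLift_uniform]
          exact tvDist_le_sum_abs _ _
      _ = ∑ π, |(convPow (transposeTopMeasure n) k - uniform (Equiv.Perm (Fin n))) π| :=
          sum_abs_fibreLift _
      _ ≤ 2 * (n * Real.exp (-(k / n))) := sum_abs_convPow_transposeTopMeasure_sub_uniform_le hk
  linarith [tvDist_triangle (convPow (warpMeasure n G) k)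
    (fibreLift G (convPow (transposeTopMeasure n) k)) (uniform (MonomialGroup n G)),
    tvDist_convPow_warpMeasure_fibreLift_le (n := n) (G := G) k]

theorem tvDist_convPow_warpMeasure_uniform_le_exp {C : ℝ} (hC : 1 ≤ C) {k : ℕ}
    (hk : n * Real.log n + C * n ≤ k) :
    tvDist (convPow (warpMeasure n G) k) (uniform (MonomialGroup n G)) ≤ 3 * Real.exp (-C) := by
  have hexp := mul_exp_neg_div_le hk
  exact (tvDist_convPow_warpMeasure_uniform_le (hexp.trans (exp_neg_le_half hC))).trans
    (by linarith)

theorem tendsto_tvDist_convPow_warpMeasure_uniform (G : ℕ+ → Type*) [∀ n, Group (G n)]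
    [∀ n, Fintype (G n)] {ε : ℝ} (hε : 0 < ε) :
    Filter.Tendsto
      (fun n : ℕ+ => tvDist (convPow (warpMeasure n (G n)) ⌊(1 + ε) * ((n : ℝ) * Real.log n)⌋₊)
        (uniform (MonomialGroup n (G n))))
      Filter.atTop (nhds 0) := by
  have hlog : Filter.Tendsto (fun n : ℕ+ => ε * Real.log n - 1) Filter.atTop Filter.atTop :=
    Filter.tendsto_atTop_add_const_right _ _ <| Filter.Tendsto.const_mul_atTop hε <|
      Real.tendsto_log_atTop.comp (tendsto_natCast_atTop_atTop.comp tendsto_PNat_val_atTop_atTop)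
  have hbound := (Real.tendsto_exp_neg_atTop_nhds_zero.comp hlog).const_mul 3
  rw [mul_zero] at hbound
  refine squeeze_zero' (Filter.Eventually.of_forall fun n => tvDist_nonneg _ _) ?_ hbound
  filter_upwards [hlog.eventually_ge_atTop 1] with n hn
  refine tvDist_convPow_warpMeasure_uniform_le_exp hn ?_
  have hfloor := Nat.sub_one_lt_floor ((1 + ε) * ((n : ℝ) * Real.log n))
  have hn₁ : (1 : ℝ) ≤ n := Nat.one_le_cast.2 n.pos
  linarith

end WarpMixing

end WarpShuffle

end

open WarpShuffle in
theorem mainTheorem6 :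
    ∃ a : ℝ,
      -- `a` is a universal constant in the bound for the transpose top with random shuffle
      (∀ (n : ℕ+) (C : ℝ), 1 < C →
        tvDist (convPow (transposeTopMeasure n) ⌈(n : ℝ) * Real.log n + C * n⌉₊)
          (uniform (Equiv.Perm (Fin n))) ≤ a * Real.exp (-C)) ∧
      ∀ (G : ℕ+ → Type*) [∀ n, Group (G n)] [∀ n, Fintype (G n)] [∀ n, Nontrivial (G n)],
        (∀ (n : ℕ+) (C : ℝ) (k : ℕ), 1 < C → (n : ℝ) * Real.log n + C * n ≤ k →
          tvDist (convPow (warpMeasure n (G n)) k) (uniform (MonomialGroup n (G n))) <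
            a * Real.exp (-C) + (Real.exp 1 + 1) * Real.exp (-C / 2)) ∧
        ∀ ε : ℝ, 0 < ε → ε < 1 →
          Filter.Tendsto
            (fun n : ℕ+ =>
              tvDist (convPow (warpMeasure n (G n)) ⌊(1 + ε) * ((n : ℝ) * Real.log n)⌋₊)
                (uniform (MonomialGroup n (G n))))
            Filter.atTop (nhds 0) := by
  refine ⟨2, fun n C hC => tvDist_convPow_transposeTopMeasure_uniform_le hC.le (Nat.le_ceil _),
    fun G _ _ _ => ⟨fun n C k hC hk => ?_,
      fun ε hε _ => tendsto_tvDist_convPow_warpMeasure_uniform G hε⟩⟩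
  calc tvDist (convPow (warpMeasure n (G n)) k) (uniform (MonomialGroup n (G n)))
      ≤ 3 * Real.exp (-C) := tvDist_convPow_warpMeasure_uniform_le_exp hC.le hk
    _ = 2 * Real.exp (-C) + 1 * Real.exp (-C) := by ring
    _ < 2 * Real.exp (-C) + (Real.exp 1 + 1) * Real.exp (-C / 2) := by
        gcongr <;> linarith [Real.exp_pos 1]
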